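/- For groups $A,B$ let $A\wr B$ be the restricted wreath product in which $A$ acts, i.e. the semidirect product of $A$ with the group $\sum_A B$ of finitely supported functions $A\to B$, on which $A$ acts by shifts; $B$ is identified with the functions supported at $e_A$. Put $G_0=\mathbb Z$ and $G_j=\mathbb Z\wr G_{j-1}$ for $j\ge 1$ (the $j$ times iterated wreath product of $\mathbb Z$ with $\mathbb Z$). Call a probability measure on $G_j$, $j\ge1$, *switch-walk-switch* if it has the form $\mu_B*\mu_A*\mu_B$, where $\mu_A$ is a probability measure on the acting group $A=\mathbb Z$ and $\mu_B$ is a probability measure on $B=G_{j-1}$, which (if $j\ge2$) is itself switch-walk-switch; for $j=1$, $\mu_B$ is any probability measure on $\mathbb Z$. Let $G$ be a group generated by a finite set $S$, with word length $l_S$, let $\mu$ be a probability measure on $G$ and $r:\mathbb N\to\mathbb R$. The random walk $(G,\mu)$ has *almost invariant distributions on the scale $r(n)$* if for every $\varepsilon>0$ and all sufficiently large $n$ there is $V_{\varepsilon,n}\subset G$ with $\mu^{*n}(V_{\varepsilon,n})\ge 1-\varepsilon$ and $$\left|\frac{\mu^{*n}(hg)}{\mu^{*n}(h)}-1\right|\le\varepsilon\qquad\text{for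 all } h\in V_{\varepsilon,n} \text{ and all } g\in G \text{ with } l_S(g)\le r(n).$$ Write $r_{\rm a.i.}(G,\mu)(n)\preceq r(n)$ (the radius of almost invariance is asymptotically at most $r$) if $(G,\mu)$ does not have almost invariant distributions on the scale $r'(n)$ for any function $r'$ such that $r'(n)/r(n)$ tends to infinity along some subsequence. **Proposition.** Let $j\ge1$ and let $\mu_j$ be a symmetric finitely supported switch-walk-switch probability measure on $G_j$. Then there is $C>0$ such that, for the word length of every finite generating set of $G_j$, $$r_{\rm a.i.}(G_j,\mu_j)(n)\preceq C\,\frac{n^{1/2^{j+1}}}{\sqrt{\ln n}}.$$ -/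

import Mathlib

open Filter Topology

noncomputable section

/-- The (restricted) wreath product of `A` and `B`, in which `A` is the acting group: pairs `(f, a)`
with `a : A` and `f : A → B` of finite support, and `(f, a) * (f', a') = (f * (x ↦ f' (a⁻¹ * x)), a * a')`.
It is realised inside the unrestricted wreath product of Mathlib. -/
def restrictedWreath (A B : Type) [Group A] [Group B] : Subgroup (RegularWreathProduct B A) where
  carrier := {c | (Function.mulSupport c.left).Finite}
  one_mem' := by simp
  mul_mem' := by
    intro c d hc hd
    simp only [Set.mem_ofPred_eq, RegularWreathProduct.mul_left] at *
    refine (hc.union (hd.image (fun x => c.right * x))).subset ?_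
    refine (Function.mulSupport_mul _ _).trans (Set.union_subset_union_right _ ?_)
    intro x hx
    exact ⟨c.right⁻¹ * x, hx, by simp⟩
  inv_mem' := by
    intro c hc
    simp only [Set.mem_ofPred_eq, RegularWreathProduct.inv_left] at *
    refine (hc.image (fun x => c.right⁻¹ * x)).subset ?_
    intro x hx
    refine ⟨c.right * x, ?_, by simp⟩
    simpa using hx

/-- The embedding of the acting group `A` in the wreath product: `a ↦ (1, a)`. -/
def walkElt {A B : Type} [Group A] [Group B] (a : A) : restrictedWreath A B :=
  ⟨⟨1, a⟩, by
    change (Function.mulSupport (1 : A → B)).Finite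
    simp⟩

open Classical in
/-- The embedding of the lamp group `B` in the wreath product, as the copy of `B` at the identity
of `A`: `b ↦ (f, 1)` with `f 1 = b` and `f x = 1` for `x ≠ 1`. -/
def switchElt {A B : Type} [Group A] [Group B] (b : B) : restrictedWreath A B :=
  ⟨⟨Pi.mulSingle 1 b, 1⟩, by
    change (Function.mulSupport (Pi.mulSingle (1 : A) b)).Finite
    exact (Set.finite_singleton 1).subset Pi.mulSupport_mulSingle_subset⟩

/-- Iterated wreath products of `ℤ` with `ℤ`, where `ℤ` acts each time:
`G 0 = ℤ` and `G (j + 1) = ℤ ≀ G j`. So `G j` is the `j` times iterated wreath product. -/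
def iterWreath : ℕ → GrpCat.{0}
  | 0 => GrpCat.of (Multiplicative ℤ)
  | j + 1 => GrpCat.of (restrictedWreath (Multiplicative ℤ) (iterWreath j))

section RandomWalk

variable {G : Type} [Group G]

/-- Convolution of two probability measures on a (discrete) group: the law of `x * y`, where `x` and
`y` are independent with laws `μ` and `ν`. -/
def pmfConv (μ ν : PMF G) : PMF G :=
  μ.bind fun x => ν.map fun y => x * y

/-- The convolution power `μ^{*n}`, the law of the random walk `(G, μ)` after `n` steps from `1`. -/
def convPow (μ : PMF G) : ℕ → PMF G
  | 0 => PMF.pure 1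
  | n + 1 => pmfConv (convPow μ n) μ

/-- `μ` is symmetric. -/
def IsSymmPMF (μ : PMF G) : Prop :=
  ∀ g, μ g⁻¹ = μ g

/-- The word length of `g` with respect to `S`: the least length of a word in the elements of `S` and
their inverses that represents `g`. It is used only for generating sets `S`. -/
def wordLength (S : Finset G) (g : G) : ℕ :=
  sInf {k | ∃ l : List G, l.length = k ∧ (∀ x ∈ l, x ∈ S ∨ x⁻¹ ∈ S) ∧ l.prod = g}

/-- The random walk `(G, μ)` has almost invariant distributions on the scale `r`: for every `ε > 0`
and every sufficiently large `n` there is a set `V` with `μ^{*n}(V) ≥ 1 - ε` such that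
`|μ^{*n}(h g) / μ^{*n}(h) - 1| ≤ ε` for all `h ∈ V` and all `g` of word length at most `r n`.
(Allowing in `V` points `h` with `μ^{*n}(h) = 0`, where the quotient is `0`, changes nothing, since
such points may be removed from `V`.) -/
def AlmostInvariantOnScale (S : Finset G) (μ : PMF G) (r : ℕ → ℝ) : Prop :=
  ∀ ε : ℝ, 0 < ε → ∀ᶠ n : ℕ in atTop, ∃ V : Set G,
    ENNReal.ofReal (1 - ε) ≤ (convPow μ n).toOuterMeasure V ∧
    ∀ h ∈ V, ∀ g : G, (wordLength S g : ℝ) ≤ r n →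
      |(convPow μ n (h * g)).toReal / (convPow μ n h).toReal - 1| ≤ ε

/-- The radius of almost invariance of `(G, μ)` is asymptotically at most `r`: whenever
`r' n / r n` tends to infinity along some subsequence, the random walk is not almost invariant on
the scale `r'`. -/
def AlmostInvarianceRadiusLE (S : Finset G) (μ : PMF G) (r : ℕ → ℝ) : Prop :=
  ∀ r' : ℕ → ℝ,
    (∃ φ : ℕ → ℕ, StrictMono φ ∧ Tendsto (fun k => r' (φ k) / r (φ k)) atTop atTop) →
    ¬ AlmostInvariantOnScale S μ r'

end RandomWalk

/-- Switch-walk-switch measures on the iterated wreath products. On `ℤ ≀ G j` such a measure is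
`μ_B * μ_A * μ_B`, where `μ_A` is a probability measure on the acting group `ℤ` and `μ_B` is a
probability measure on the lamp group `G j`, which is itself switch-walk-switch if `j ≥ 1` and
arbitrary on `G 0 = ℤ`. -/
def IsSwitchWalkSwitch : (j : ℕ) → PMF (iterWreath j) → Prop
  | 0, _ => True
  | j + 1, μ => ∃ (μA : PMF (Multiplicative ℤ)) (μB : PMF (iterWreath j)),
      IsSwitchWalkSwitch j μB ∧
      μ = pmfConv (pmfConv
            (μB.map (switchElt (A := Multiplicative ℤ) (B := iterWreath j)))
            (μA.map (walkElt (A := Multiplicative ℤ) (B := iterWreath j))))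
          (μB.map (switchElt (A := Multiplicative ℤ) (B := iterWreath j)))

end

/-! If the walk were almost invariant on a scale far above `r`, no translations of length `O(r)`
could move much mass, even if the translation depends on the position. It is therefore enough to
find a map `h ↦ g h * h`, injective on a set of full mass, whose image has mass at most `1 - c₀`,
where every `g h` is short. This is `DisplacesMass`, and `DisplacesMass.almostInvarianceRadiusLE`
draws the conclusion. Symmetry of the measure exchanges left translations with the right
translations of the definition. The shape `x ^ k * y ^ l * (x ^ k)⁻¹` of `g h` bounds its length for
every generating set at once and is preserved by homomorphisms.

For `ℤ ≀ ℤ` (`displacesMass_swsMeasure_int`) put `s = √N`. Given the path of the walker, the lamps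
are independent walks on `ℤ`, run for as many steps as they were switched
(`expect_convPow_swsMeasure`). With probability at least `1 / 32`, all lamps in a window of about `s
^ (1/4)` sites have been switched about `s` times (`exists_pathAvg_visitCount_ge`). Take a threshold
`T` of order `√(s log s)`: the window very likely contains a lamp above `T`, yet the tail of a lamp
drops by a factor `4` from `T` to `T + L`, with `L` of order `√(s / log s)` (`exists_window`). Let
`g h` raise the first lamp above `T` by `L`. The position of that lamp is unchanged, so the map is
injective. In its image either no lamp exceeds `T` or the first one that does exceeds `T + L`, which
has conditional probability at most `1 / 2` on such paths. The logarithm in the radius thus comes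
from choosing the best among polynomially many independent lamps.

Each further wreath product halves the exponent (`DisplacesMass.swsMeasure`): the lamp at the
identity is switched about `√N` times with probability bounded below, and the displacement of the
lamp group is applied to that lamp. The number of switches is random, so one displacement has to
serve all times comparable with `N`; hence the range of `m` in `DisplacesMass`.

If the walker or the integer lamps never move, the walk stays in a proper subgroup and one fixed
translation displaces everything (`displacesMass_of_subgroup`). -/

open scoped ENNReal

/-! ### Expectations and probabilities for probability mass functions -/

section Expectation

variable {α β : Type*}

/-- The expectation of a nonnegative function under a probability mass function. -/
noncomputable def expect (p : PMF α) (F : α → ℝ≥0∞) : ℝ≥0∞ := ∑' a, p a * F a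

/-- The probability of a set under a probability mass function. -/
noncomputable def prob (p : PMF α) (s : Set α) : ℝ≥0∞ := expect p (s.indicator 1)

theorem toOuterMeasure_eq_prob (p : PMF α) (s : Set α) : p.toOuterMeasure s = prob p s := by
  classical
  rw [PMF.toOuterMeasure_apply, prob, expect]
  refine tsum_congr fun a => ?_
  by_cases h : a ∈ s <;> simp [h]

theorem expect_pure (a : α) (F : α → ℝ≥0∞) : expect (PMF.pure a) F = F a := by
  classical
  rw [expect, tsum_eq_single a]
  · simp
  · intro b hb
    simp [PMF.pure_apply, hb]

theorem expect_bind (p : PMF α) (f : α → PMF β) (F : β → ℝ≥0∞) :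
    expect (p.bind f) F = expect p fun a => expect (f a) F := by
  simp only [expect, PMF.bind_apply, ← ENNReal.tsum_mul_right, ← ENNReal.tsum_mul_left]
  rw [ENNReal.tsum_comm]
  simp only [mul_assoc]

theorem expect_map (p : PMF α) (f : α → β) (F : β → ℝ≥0∞) :
    expect (p.map f) F = expect p fun a => F (f a) := by
  rw [← PMF.bind_pure_comp, expect_bind]
  simp [expect_pure]

theorem expect_congr (p : PMF α) {F F' : α → ℝ≥0∞} (h : ∀ a ∈ p.support, F a = F' a) :
    expect p F = expect p F' := by
  refine tsum_congr fun a => ?_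
  by_cases ha : p a = 0
  · simp [ha]
  · rw [h a ha]

theorem expect_mono (p : PMF α) {F F' : α → ℝ≥0∞} (h : ∀ a, F a ≤ F' a) :
    expect p F ≤ expect p F' :=
  ENNReal.tsum_le_tsum fun a => by gcongr; exact h a

theorem expect_const (p : PMF α) (c : ℝ≥0∞) : expect p (fun _ => c) = c := by
  simp [expect, ENNReal.tsum_mul_right, p.tsum_coe]

theorem expect_mul_left (p : PMF α) (c : ℝ≥0∞) (F : α → ℝ≥0∞) :
    expect p (fun a => c * F a) = c * expect p F := by
  simp only [expect, ← ENNReal.tsum_mul_left]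
  exact tsum_congr fun a => by ring

theorem expect_mul_right (p : PMF α) (c : ℝ≥0∞) (F : α → ℝ≥0∞) :
    expect p (fun a => F a * c) = expect p F * c := by
  simp only [mul_comm _ c, expect_mul_left]

theorem expect_add (p : PMF α) (F F' : α → ℝ≥0∞) :
    expect p (fun a => F a + F' a) = expect p F + expect p F' := by
  simp [expect, mul_add, ENNReal.tsum_add]

theorem expect_finset_sum {ι : Type*} (p : PMF α) (s : Finset ι) (F : ι → α → ℝ≥0∞) :
    expect p (fun a => ∑ i ∈ s, F i a) = ∑ i ∈ s, expect p (F i) := by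
  classical
  induction s using Finset.induction_on with
  | empty => simp [expect_const]
  | insert i s hi ih => simp [Finset.sum_insert hi, expect_add, ih]

theorem expect_comm (p : PMF α) (q : PMF β) (F : α → β → ℝ≥0∞) :
    expect p (fun a => expect q fun b => F a b) = expect q fun b => expect p fun a => F a b := by
  simp only [expect, ← ENNReal.tsum_mul_left]
  rw [ENNReal.tsum_comm]
  exact tsum_congr fun a => tsum_congr fun b => by ring

theorem prob_le_one (p : PMF α) (s : Set α) : prob p s ≤ 1 := by
  calc prob p s ≤ expect p (fun _ => 1) :=
        expect_mono p fun a => Set.indicator_le_self' (fun _ _ => zero_le) a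
    _ = 1 := expect_const p 1

theorem prob_eq_one (p : PMF α) {s : Set α} (h : p.support ⊆ s) : prob p s = 1 := by
  rw [prob, expect_congr p (F' := fun _ => 1), expect_const]
  intro a ha
  simp [h ha]

theorem prob_add_prob_compl (p : PMF α) (s : Set α) : prob p s + prob p sᶜ = 1 := by
  rw [prob, prob, ← expect_add, ← expect_const p 1]
  refine expect_congr p fun a _ => ?_
  by_cases h : a ∈ s <;> simp [h]

end Expectation

/-! ### Convolution powers and symmetry -/

section Convolution

variable {G : Type} [Group G]

theorem expect_pmfConv (μ ν : PMF G) (F : G → ℝ≥0∞) :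
    expect (pmfConv μ ν) F = expect μ fun x => expect ν fun y => F (x * y) := by
  simp [pmfConv, expect_bind, expect_map]

theorem expect_convPow_succ (μ : PMF G) (n : ℕ) (F : G → ℝ≥0∞) :
    expect (convPow μ (n + 1)) F
      = expect (convPow μ n) fun x => expect μ fun y => F (x * y) :=
  expect_pmfConv _ _ _

/-- Splitting off the first step instead of the last one matches the recursions along paths, which
prepend steps. -/
theorem expect_convPow_succ' (μ : PMF G) (n : ℕ) (F : G → ℝ≥0∞) :
    expect (convPow μ (n + 1)) F
      = expect μ fun x => expect (convPow μ n) fun y => F (x * y) := by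
  induction n generalizing F with
  | zero => simp [convPow, expect_pmfConv, expect_pure]
  | succ n ih =>
    rw [expect_convPow_succ, ih]
    simp only [expect_convPow_succ μ n, mul_assoc]

theorem prob_singleton {α : Type*} (p : PMF α) (a : α) : prob p {a} = p a := by
  rw [← toOuterMeasure_eq_prob, PMF.toOuterMeasure_apply_singleton]

theorem expect_inv {μ : PMF G} (hμ : IsSymmPMF μ) (F : G → ℝ≥0∞) :
    expect μ (fun x => F x⁻¹) = expect μ F := by
  rw [expect, expect, ← (Equiv.inv G).tsum_eq]
  simp [hμ _]

/-- Inversion reverses the order of the independent steps and inverts each of them; neither changes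
the law. -/
theorem expect_convPow_inv {μ : PMF G} (hμ : IsSymmPMF μ) (n : ℕ) (F : G → ℝ≥0∞) :
    expect (convPow μ n) (fun x => F x⁻¹) = expect (convPow μ n) F := by
  induction n generalizing F with
  | zero => simp [convPow, expect_pure]
  | succ n ih =>
    rw [expect_convPow_succ, expect_convPow_succ']
    simp only [mul_inv_rev]
    rw [expect_comm, ← expect_inv hμ]
    refine expect_congr μ fun y _ => ?_
    simp only [inv_inv]
    exact ih fun x => F (y * x)

theorem IsSymmPMF.convPow {μ : PMF G} (hμ : IsSymmPMF μ) (n : ℕ) : IsSymmPMF (convPow μ n) := by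
  classical
  intro g
  rw [← prob_singleton, ← prob_singleton, prob, prob, ← expect_convPow_inv hμ]
  refine expect_congr _ fun x _ => ?_
  by_cases h : x = g <;> simp [Set.indicator, h]

theorem convPow_support_subset {μ : PMF G} {H : Subgroup G} (h : ∀ g ∈ μ.support, g ∈ H) (n : ℕ) :
    (convPow μ n).support ⊆ H := by
  induction n with
  | zero => simp [convPow, H.one_mem]
  | succ n ih =>
    intro g hg
    simp only [convPow, pmfConv, PMF.mem_support_bind_iff, PMF.mem_support_map_iff] at hg
    obtain ⟨x, hx, y, hy, rfl⟩ := hg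
    exact H.mul_mem (ih hx) (h y hy)

end Convolution

/-! ### Word length -/

section WordLength

variable {G : Type} [Group G] {S : Finset G}

theorem wordLength_le {l : List G} (h : ∀ x ∈ l, x ∈ S ∨ x⁻¹ ∈ S) :
    wordLength S l.prod ≤ l.length :=
  Nat.sInf_le ⟨l, rfl, h, rfl⟩

theorem exists_word (hS : Subgroup.closure (S : Set G) = ⊤) (g : G) :
    ∃ l : List G, l.length = wordLength S g ∧ (∀ x ∈ l, x ∈ S ∨ x⁻¹ ∈ S) ∧ l.prod = g := by
  have hne : {k | ∃ l : List G, l.length = k ∧ (∀ x ∈ l, x ∈ S ∨ x⁻¹ ∈ S) ∧ l.prod = g}.Nonempty := by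
    have hg : g ∈ (Subgroup.closure (S : Set G)).toSubmonoid := hS ▸ Subgroup.mem_top g
    rw [Subgroup.closure_toSubmonoid] at hg
    obtain ⟨l, hl, rfl⟩ := Submonoid.exists_list_of_mem_closure hg
    exact ⟨_, l, rfl, by simpa using hl, rfl⟩
  exact Nat.sInf_mem hne

theorem wordLength_one : wordLength S (1 : G) = 0 :=
  Nat.le_zero.1 (wordLength_le (S := S) (l := []) (by simp))

theorem wordLength_mul_le (hS : Subgroup.closure (S : Set G) = ⊤) (g h : G) :
    wordLength S (g * h) ≤ wordLength S g + wordLength S h := by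
  obtain ⟨l, hl, hlS, rfl⟩ := exists_word hS g
  obtain ⟨l', hl', hlS', rfl⟩ := exists_word hS h
  rw [← List.prod_append, ← hl, ← hl', ← List.length_append]
  refine wordLength_le fun x hx => ?_
  rcases List.mem_append.1 hx with hx | hx
  exacts [hlS x hx, hlS' x hx]

theorem wordLength_inv_le (hS : Subgroup.closure (S : Set G) = ⊤) (g : G) :
    wordLength S g⁻¹ ≤ wordLength S g := by
  obtain ⟨l, hl, hlS, rfl⟩ := exists_word hS g
  rw [List.prod_inv_reverse, ← hl]
  refine (wordLength_le ?_).trans (by simp)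
  intro x hx
  simp only [List.mem_reverse, List.mem_map] at hx
  obtain ⟨y, hy, rfl⟩ := hx
  simpa using (hlS y hy).symm

theorem wordLength_pow_le (hS : Subgroup.closure (S : Set G) = ⊤) (g : G) (k : ℕ) :
    wordLength S (g ^ k) ≤ k * wordLength S g := by
  induction k with
  | zero => simp [wordLength_one]
  | succ k ih =>
    rw [pow_succ, add_mul, one_mul]
    exact (wordLength_mul_le hS _ _).trans (by gcongr)

theorem wordLength_conj_pow_le (hS : Subgroup.closure (S : Set G) = ⊤) (x y : G) (k l : ℕ) :
    wordLength S (x ^ k * y ^ l * (x ^ k)⁻¹)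
      ≤ 2 * k * wordLength S x + l * wordLength S y := by
  have h1 := wordLength_mul_le hS (x ^ k * y ^ l) (x ^ k)⁻¹
  have h2 := wordLength_mul_le hS (x ^ k) (y ^ l)
  have h3 := wordLength_inv_le hS (x ^ k)
  have h4 := wordLength_pow_le hS x k
  have h5 := wordLength_pow_le hS y l
  linarith

end WordLength

/-! ### Displacement of mass bounds the radius of almost invariance -/

section Displacement

/-- The scale `N ^ α / √(log N)`. -/
noncomputable def logScale (α : ℝ) (N : ℕ) : ℝ := (N : ℝ) ^ α / Real.sqrt (Real.log N)

theorem logScale_nonneg (α : ℝ) (N : ℕ) : 0 ≤ logScale α N := by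
  unfold logScale; positivity

theorem tendsto_logScale {α : ℝ} (hα : 0 < α) : Tendsto (logScale α) atTop atTop := by
  have h1 : Tendsto (fun N : ℕ => Real.log N / (N : ℝ) ^ (2 * α)) atTop (𝓝 0) :=
    ((isLittleO_log_rpow_atTop (by positivity : 0 < 2 * α)).tendsto_div_nhds_zero).comp
      tendsto_natCast_atTop_atTop
  have h2 : Tendsto (fun N : ℕ => Real.sqrt (Real.log N / (N : ℝ) ^ (2 * α))) atTop (𝓝[>] 0) := by
    refine tendsto_nhdsWithin_iff.2 ⟨by simpa using h1.sqrt, ?_⟩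
    filter_upwards [eventually_gt_atTop 1] with N hN
    have : 0 < Real.log N := Real.log_pos (by exact_mod_cast hN)
    have : (0 : ℝ) < N := by positivity
    exact Real.sqrt_pos.2 (by positivity)
  refine (tendsto_inv_nhdsGT_zero.comp h2).congr fun N => ?_
  have h3 : (N : ℝ) ^ (2 * α) = ((N : ℝ) ^ α) ^ 2 := by
    rw [← Real.rpow_natCast, ← Real.rpow_mul (by positivity), mul_comm]; norm_num
  simp only [Function.comp, logScale, h3]
  rw [Real.sqrt_div' _ (by positivity), Real.sqrt_sq (by positivity), inv_div]

variable {G : Type} [Group G]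

/-- At times comparable with `N`, a definite part of the mass of the random walk is moved off a set of
full mass by left translation by elements `x ^ k * y ^ l * (x ^ k)⁻¹` that may depend on the
position, with `k` and `l` of order `logScale α N`. -/
def DisplacesMass (μ : PMF G) (α : ℝ) : Prop :=
  ∃ x y : G, ∃ c₀ : ℝ, 0 < c₀ ∧ c₀ ≤ 1 ∧ ∀ c C : ℝ, 0 < c → ∃ K : ℝ, ∀ᶠ N : ℕ in atTop,
    ∃ (g : G → G) (E F : Set G),
      Set.InjOn (fun h => g h * h) E ∧ Set.MapsTo (fun h => g h * h) E F ∧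
      (∀ h, ∃ k l : ℕ, (k : ℝ) ≤ K * logScale α N ∧ (l : ℝ) ≤ K * logScale α N ∧
        g h = x ^ k * y ^ l * (x ^ k)⁻¹) ∧
      (∀ m, prob (convPow μ m) E = 1) ∧
      ∀ m : ℕ, c * N ≤ m → m ≤ C * N → prob (convPow μ m) F ≤ ENNReal.ofReal (1 - c₀)

/-- Translation by `y` carries `H`, which has full mass, into its complement, which has mass zero.
This case is the reason for the set `E` in `DisplacesMass`. -/
theorem displacesMass_of_subgroup {μ : PMF G} {H : Subgroup G} (hH : ∀ g ∈ μ.support, g ∈ H)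
    {y : G} (hy : y ∉ H) {α : ℝ} (hα : 0 < α) : DisplacesMass μ α := by
  refine ⟨1, y, 1, one_pos, le_rfl, fun c C _ => ⟨1, ?_⟩⟩
  filter_upwards [(tendsto_logScale hα).eventually_ge_atTop 1] with N hN
  refine ⟨fun _ => y, H, (H : Set G)ᶜ, (mul_right_injective y).injOn, ?_, ?_, ?_, ?_⟩
  · intro h hh hyh
    exact hy ((H.mul_mem_cancel_right hh).1 hyh)
  · exact fun h => ⟨0, 1, by simpa using zero_le_one.trans hN, by simpa using hN, by simp⟩
  · exact fun m => prob_eq_one _ (convPow_support_subset hH m)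
  · intro m _ _
    have h1 := prob_add_prob_compl (convPow μ m) (H : Set G)
    rw [prob_eq_one _ (convPow_support_subset hH m)] at h1
    have h2 : prob (convPow μ m) (H : Set G)ᶜ = 0 := by
      refine (ENNReal.add_right_inj ENNReal.one_ne_top).1 ?_
      rw [h1, add_zero]
    simp [h2]

/-- A map that is injective on `V` and does not decrease masses there by more than a factor `1 - ε`
maps `V` to a set of almost the same mass. -/
theorem prob_le_of_injOn {β : Type*} (p : PMF β) {φ : β → β} {V F : Set β} {δ : ℝ≥0∞}
    (hinj : Set.InjOn φ V) (hmaps : Set.MapsTo φ V F) (hφ : ∀ h ∈ V, δ * p h ≤ p (φ h)) :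
    δ * prob p V ≤ prob p F := by
  rw [← toOuterMeasure_eq_prob, ← toOuterMeasure_eq_prob, PMF.toOuterMeasure_apply,
    PMF.toOuterMeasure_apply, ← tsum_subtype, ← tsum_subtype, ← ENNReal.tsum_mul_left]
  let ψ : V → F := fun h => ⟨φ h, hmaps h.2⟩
  have hψ : Function.Injective ψ := by
    intro a b hab
    exact Subtype.ext (hinj a.2 b.2 (congrArg Subtype.val hab))
  calc ∑' h : V, δ * p h ≤ ∑' h : V, p (ψ h) := ENNReal.tsum_le_tsum fun h => hφ h h.2
    _ ≤ ∑' x : F, p x := ENNReal.tsum_comp_le_tsum_of_injective hψ fun x : F => p x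

/-- Almost invariance would make the displacement preserve point masses up to a factor `1 - ε` on a
set of mass `1 - ε`; being injective, it would then have an image of mass at least `(1 - ε) ^ 2`,
more than `F` has. -/
theorem DisplacesMass.almostInvarianceRadiusLE {μ : PMF G} (hμ : IsSymmPMF μ) {α : ℝ} (hα : 0 < α)
    (h : DisplacesMass μ α) {S : Finset G} (hS : Subgroup.closure (S : Set G) = ⊤) :
    AlmostInvarianceRadiusLE S μ (logScale α) := by
  rintro r' ⟨φ, hφ, hr⟩ hai
  obtain ⟨x, y, c₀, hc₀, hc₁, h⟩ := h
  -- Only the time `m = N` is needed here; the wider range of times serves the induction.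
  obtain ⟨K, hK⟩ := h 1 1 one_pos
  set ε : ℝ := c₀ / 4 with hε
  have hev := hφ.tendsto_atTop.eventually ((hai ε (by positivity)).and (hK.and
    ((tendsto_logScale hα).eventually_gt_atTop 0)))
  obtain ⟨i, ⟨⟨V, hV, hVinv⟩, ⟨g, E, F, hinj, hmaps, hg, hE, hF⟩, hpos⟩, hri⟩ := (hev.and
    (hr.eventually_ge_atTop ((2 * wordLength S x + wordLength S y) * K))).exists
  set n := φ i
  have hrn : (2 * wordLength S x + wordLength S y) * (K * logScale α n) ≤ r' n := by
    rw [le_div_iff₀ hpos] at hri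
    linarith
  set p := convPow μ n with hp
  set W : Set G := {w | w⁻¹ ∈ V} ∩ E with hW
  have hlen : ∀ w, (wordLength S (g w)⁻¹ : ℝ) ≤ r' n := by
    intro w
    obtain ⟨k, l, hk, hl, hgw⟩ := hg w
    refine le_trans ?_ hrn
    have h1 : (wordLength S (g w)⁻¹ : ℝ) ≤ 2 * k * wordLength S x + l * wordLength S y := by
      rw [hgw]
      exact_mod_cast (wordLength_inv_le hS _).trans (wordLength_conj_pow_le hS x y k l)
    have h2 : (k : ℝ) * wordLength S x ≤ (K * logScale α n) * wordLength S x := by gcongr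
    have h3 : (l : ℝ) * wordLength S y ≤ (K * logScale α n) * wordLength S y := by gcongr
    linarith
  have hmass : ∀ w ∈ W, ENNReal.ofReal (1 - ε) * p w ≤ p (g w * w) := by
    intro w hw
    have h1 := hVinv w⁻¹ hw.1 (g w)⁻¹ (hlen w)
    -- Right translation of `w⁻¹` by `(g w)⁻¹` gives the inverse of `g w * w`, and inverses have
    -- equal mass.
    rw [← mul_inv_rev, hμ.convPow n, hμ.convPow n] at h1
    rw [← ENNReal.toReal_le_toReal (ENNReal.mul_ne_top ENNReal.ofReal_ne_top (PMF.apply_ne_top _ _))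
      (PMF.apply_ne_top _ _), ENNReal.toReal_mul, ENNReal.toReal_ofReal (by linarith)]
    rcases (ENNReal.toReal_nonneg (a := p w)).eq_or_lt with h0 | h0
    · rw [← h0, mul_zero]; exact ENNReal.toReal_nonneg
    · have h2 := (abs_le.1 h1).1
      have h3 : 1 - ε ≤ (p (g w * w)).toReal / (p w).toReal := by linarith
      rwa [le_div_iff₀ h0] at h3
  have h1 : ENNReal.ofReal (1 - ε) * prob p W ≤ prob p F :=
    prob_le_of_injOn p (hinj.mono Set.inter_subset_right)
      (hmaps.mono_left Set.inter_subset_right) hmass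
  have h2 : ENNReal.ofReal (1 - ε) ≤ prob p W := by
    calc ENNReal.ofReal (1 - ε) ≤ prob p V := by rw [← toOuterMeasure_eq_prob]; exact hV
      _ = prob p {w | w⁻¹ ∈ V} := by
        rw [prob, ← expect_convPow_inv hμ]
        rfl
      _ = prob p W := by
        have hEp := hE n
        rw [← hp, ← toOuterMeasure_eq_prob, PMF.toOuterMeasure_apply_eq_one_iff] at hEp
        refine expect_congr p fun a ha => ?_
        by_cases hav : a⁻¹ ∈ V <;> simp [hW, Set.indicator, hEp ha, hav]
  have h3 : ENNReal.ofReal (1 - ε) * ENNReal.ofReal (1 - ε) ≤ ENNReal.ofReal (1 - c₀) :=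
    (mul_le_mul_right h2 _).trans (h1.trans (hF n (by simp) (by simp)))
  rw [← ENNReal.ofReal_mul (by linarith),
    ENNReal.ofReal_le_ofReal_iff (by linarith)] at h3
  -- With `ε = c₀ / 4`, `(1 - ε) ^ 2 = 1 - c₀ / 2 + c₀ ^ 2 / 16` exceeds `1 - c₀`.
  nlinarith

end Displacement

/-! ### Paths of the walker and switch counts -/

section Path

/-- The law of the list of the first `n` steps of the random walk with step distribution `μ`. -/
noncomputable def pathLaw {A : Type} (μ : PMF A) : ℕ → PMF (List A)
  | 0 => PMF.pure []
  | n + 1 => μ.bind fun a => (pathLaw μ n).map (List.cons a)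

theorem expect_pathLaw_succ {A : Type} (μ : PMF A) (n : ℕ) (F : List A → ℝ≥0∞) :
    expect (pathLaw μ (n + 1)) F
      = expect μ fun a => expect (pathLaw μ n) fun l => F (a :: l) := by
  simp [pathLaw, expect_bind, expect_map]

variable {A : Type} [Group A] [DecidableEq A]

/-- The number of times that a switch-walk-switch walker starting at `x` and making the steps `l`
switches the lamp at `y`. -/
def visitCount : A → List A → A → ℕ
  | _, [], _ => 0
  | x, a :: l, y => (if x = y then 1 else 0) + ((if x * a = y then 1 else 0) + visitCount (x * a) l y)

end Path

/-! ### Switch-walk-switch walks: lamps are independent given the path -/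

section Wreath

variable {A B : Type} [Group A] [Group B]

theorem walkElt_mul (a a' : A) :
    walkElt (A := A) (B := B) (a * a') = walkElt a * walkElt a' := by
  refine Subtype.ext (RegularWreathProduct.ext ?_ rfl)
  funext z
  simp [walkElt]

theorem walkElt_one : walkElt (A := A) (B := B) 1 = 1 := rfl

theorem switchElt_mul (b b' : B) :
    switchElt (A := A) (B := B) (b * b') = switchElt b * switchElt b' := by
  classical
  refine Subtype.ext (RegularWreathProduct.ext ?_ (by simp [switchElt]))
  funext z
  by_cases h : z = 1 <;> simp [switchElt, h]

/-- `walkElt` as a homomorphism. -/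
def walkHom (A B : Type) [Group A] [Group B] : A →* restrictedWreath A B where
  toFun := walkElt
  map_one' := walkElt_one
  map_mul' := walkElt_mul

/-- `switchElt` as a homomorphism. -/
noncomputable def switchHom (A B : Type) [Group A] [Group B] : B →* restrictedWreath A B :=
  MonoidHom.mk' switchElt switchElt_mul

theorem switchElt_left_one (b : B) : (switchElt (A := A) b).1.left 1 = b := by
  simp [switchElt]

theorem switchElt_left_of_ne (b : B) {z : A} (hz : z ≠ 1) : (switchElt (A := A) b).1.left z = 1 := by
  simp [switchElt, hz]

theorem switchElt_right (b : B) : (switchElt (A := A) b).1.right = 1 := rfl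

theorem walkElt_right (a : A) : (walkElt (B := B) a).1.right = a := rfl

theorem walkElt_left (a : A) : (walkElt (B := B) a).1.left = 1 := rfl

theorem wreath_mul_left (g h : restrictedWreath A B) (z : A) :
    (g * h).1.left z = g.1.left z * h.1.left (g.1.right⁻¹ * z) := rfl

theorem wreath_mul_right (g h : restrictedWreath A B) :
    (g * h).1.right = g.1.right * h.1.right := rfl

/-- The switch-walk-switch measure with lamp measure `μB` and walk measure `μA`. -/
noncomputable def swsMeasure (μA : PMF A) (μB : PMF B) : PMF (restrictedWreath A B) :=
  pmfConv (pmfConv (μB.map (switchElt (A := A) (B := B))) (μA.map (walkElt (A := A) (B := B))))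
    (μB.map (switchElt (A := A) (B := B)))

theorem expect_swsMeasure (μA : PMF A) (μB : PMF B) (F : restrictedWreath A B → ℝ≥0∞) :
    expect (swsMeasure μA μB) F = expect μA fun a => expect μB fun b => expect μB fun b' =>
      F (switchElt b * walkElt a * switchElt b') := by
  rw [expect_comm]
  simp [swsMeasure, expect_pmfConv, expect_map]

/-- The coordinate `x⁻¹ * y` is the site `y` seen by a walker at `x`. One step switches the lamps at
its start `x` and its end `x * a`; the remaining steps `h` are then seen from `x * a`. -/
theorem sws_mul_left [DecidableEq A] (x y a : A) (b b' : B) (h : restrictedWreath A B) :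
    (switchElt b * walkElt a * switchElt b' * h).1.left (x⁻¹ * y)
      = (if x = y then b else 1) * ((if x * a = y then b' else 1) * h.1.left ((x * a)⁻¹ * y)) := by
  have e1 : x⁻¹ * y = 1 ↔ x = y := by rw [inv_mul_eq_one]
  have e2 : a⁻¹ * (x⁻¹ * y) = 1 ↔ x * a = y := by
    rw [← mul_assoc, ← mul_inv_rev, inv_mul_eq_one]
  simp only [wreath_mul_left, switchElt_right, walkElt_right, walkElt_left, one_mul, Pi.one_apply,
    mul_assoc, inv_one, mul_inv_rev]
  congr 1
  · split_ifs with h1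
    · rw [e1.2 h1, switchElt_left_one]
    · exact switchElt_left_of_ne _ (mt e1.1 h1)
  · congr 1
    split_ifs with h1
    · rw [e2.2 h1, switchElt_left_one]
    · exact switchElt_left_of_ne _ (mt e2.1 h1)

omit [Group A] in
-- A switch at `x` affects at most one factor, so the average over it passes into the product.
theorem expect_prod_ite [DecidableEq A] (μ : PMF B) (x : A) (Y : Finset A) (Φ : A → B → ℝ≥0∞) :
    expect μ (fun b => ∏ y ∈ Y, Φ y (if x = y then b else 1))
      = ∏ y ∈ Y, if x = y then expect μ (Φ y) else Φ y 1 := by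
  by_cases hx : x ∈ Y
  · have h1 : ∀ b, ∏ y ∈ Y.erase x, Φ y (if x = y then b else 1) = ∏ y ∈ Y.erase x, Φ y 1 :=
      fun b => Finset.prod_congr rfl fun y hy => by rw [if_neg (Finset.ne_of_mem_erase hy).symm]
    simp only [← Finset.mul_prod_erase Y _ hx, h1, if_true, expect_mul_right]
    congr 1
    exact Finset.prod_congr rfl fun y hy => by rw [if_neg (Finset.ne_of_mem_erase hy).symm]
  · rw [← expect_const μ (∏ y ∈ Y, _)]
    refine expect_congr μ fun b _ => Finset.prod_congr rfl fun y hy => ?_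
    have : x ≠ y := fun h => hx (h ▸ hy)
    rw [if_neg this, if_neg this]

/-- Given the path of the walker, the lamps are independent, and the lamp at `y` is distributed as
the random walk with step distribution `μB` at time `visitCount 1 l y`. -/
theorem expect_convPow_swsMeasure [DecidableEq A] (μA : PMF A) (μB : PMF B) (n : ℕ) (x : A)
    (Y : Finset A) (F : A → B → ℝ≥0∞) :
    expect (convPow (swsMeasure μA μB) n) (fun h => ∏ y ∈ Y, F y (h.1.left (x⁻¹ * y)))
      = expect (pathLaw μA n)
          fun l => ∏ y ∈ Y, expect (convPow μB (visitCount x l y)) (F y) := by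
  induction n generalizing x F with
  | zero => simp [convPow, pathLaw, expect_pure, visitCount]
  | succ n ih =>
    rw [expect_convPow_succ', expect_swsMeasure, expect_pathLaw_succ]
    refine expect_congr μA fun a _ => ?_
    simp only [sws_mul_left]
    -- The two switches of the first step are absorbed into the test functions, which is why the
    -- induction is over all `F` and all starting points.
    have h1 : ∀ b b' : B, expect (convPow (swsMeasure μA μB) n)
        (fun h => ∏ y ∈ Y, F y ((if x = y then b else 1) *
          ((if x * a = y then b' else 1) * h.1.left ((x * a)⁻¹ * y)))) =
        expect (pathLaw μA n) fun l => ∏ y ∈ Y, expect (convPow μB (visitCount (x * a) l y))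
          fun c => F y ((if x = y then b else 1) * ((if x * a = y then b' else 1) * c)) :=
      fun b b' => ih (x * a)
        fun y c => F y ((if x = y then b else 1) * ((if x * a = y then b' else 1) * c))
    simp only [h1]
    simp only [expect_comm μB (pathLaw μA n)]
    refine expect_congr _ fun l _ => ?_
    have h2 : ∀ b : B, expect μB (fun b' => ∏ y ∈ Y, expect (convPow μB (visitCount (x * a) l y))
          fun c => F y ((if x = y then b else 1) * ((if x * a = y then b' else 1) * c))) =
        ∏ y ∈ Y, if x * a = y then expect μB (fun b' => expect (convPow μB (visitCount (x * a) l y))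
          fun c => F y ((if x = y then b else 1) * (b' * c))) else
          expect (convPow μB (visitCount (x * a) l y))
            fun c => F y ((if x = y then b else 1) * (1 * c)) :=
      fun b => expect_prod_ite μB (x * a) Y fun y b' =>
        expect (convPow μB (visitCount (x * a) l y))
          fun c => F y ((if x = y then b else 1) * (b' * c))
    simp only [h2]
    rw [expect_prod_ite μB x Y fun y u => if x * a = y then
        expect μB (fun b' => expect (convPow μB (visitCount (x * a) l y))
          fun c => F y (u * (b' * c))) else
          expect (convPow μB (visitCount (x * a) l y)) fun c => F y (u * (1 * c))]
    refine Finset.prod_congr rfl fun y _ => ?_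
    rw [visitCount]
    generalize visitCount (x * a) l y = N
    split_ifs <;> simp only [zero_add, Nat.add_comm 1, expect_convPow_succ', one_mul]

end Wreath

/-! ### Symmetry and finite support pass to the walk and lamp measures -/

section Inherit

variable {A B : Type} [Group A] [Group B]

/-- When the walker moves, the two switches act at different sites, so the product determines its
three factors. For `a = 1` the switches would merge into `b * b'`. -/
theorem prob_swsMeasure (μA : PMF A) (μB : PMF B) {a : A} (ha : a ≠ 1) (b b' : B) :
    swsMeasure μA μB (switchElt b * walkElt a * switchElt b') = μA a * (μB b * μB b') := by
  classical
  have h0 : μA a * (μB b * μB b') = expect μA fun a₁ => expect μB fun b₁ => expect μB fun b₁' =>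
      ({a} : Set A).indicator 1 a₁ *
        (({b} : Set B).indicator 1 b₁ * ({b'} : Set B).indicator 1 b₁') := by
    simp only [expect_mul_left, expect_mul_right, ← prob.eq_def, prob_singleton]
  rw [← prob_singleton, prob, expect_swsMeasure, h0]
  refine expect_congr μA fun a₁ _ => expect_congr μB fun b₁ _ => expect_congr μB fun b₁' _ => ?_
  have key : switchElt b₁ * walkElt a₁ * switchElt b₁' = switchElt b * walkElt a * switchElt b' ↔
      a₁ = a ∧ b₁ = b ∧ b₁' = b' := by
    refine ⟨fun h => ?_, by rintro ⟨rfl, rfl, rfl⟩; rfl⟩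
    have hr := congrArg (fun g => g.1.right) h
    simp only [wreath_mul_right, switchElt_right, walkElt_right, one_mul, mul_one] at hr
    subst hr
    have hl : ∀ z : A, _ := fun z => congrArg (fun g => g.1.left z) h
    have h0 := hl 1
    have h1 := hl a₁
    have ha' : a₁⁻¹ ≠ 1 := by simpa using ha
    simp only [wreath_mul_left, wreath_mul_right, switchElt_right, walkElt_right, walkElt_left,
      one_mul, mul_one, Pi.one_apply, inv_mul_cancel, switchElt_left_one, switchElt_left_of_ne _ ha,
      switchElt_left_of_ne _ ha'] at h0 h1
    exact ⟨rfl, h0, h1⟩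
  simp only [Set.indicator, Set.mem_singleton_iff, key, Pi.one_apply]
  by_cases h1 : a₁ = a <;> by_cases h2 : b₁ = b <;> by_cases h3 : b₁' = b' <;> simp [h1, h2, h3]

theorem walk_isSymm {μA : PMF A} {μB : PMF B} (h : IsSymmPMF (swsMeasure μA μB)) :
    IsSymmPMF μA := by
  classical
  have key : ∀ F : A → ℝ≥0∞, expect (swsMeasure μA μB) (fun g => F g.1.right) = expect μA F := by
    intro F
    rw [expect_swsMeasure]
    simp [switchElt_right, walkElt_right, expect_const]
  intro a
  rw [← prob_singleton, ← prob_singleton, prob, prob, ← key, ← key, ← expect_inv h]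
  refine expect_congr _ fun g _ => ?_
  by_cases hg : g.1.right = a <;> simp [Set.indicator, hg]

/-- Comparing the masses of `b a b` and its inverse gives `μB b⁻¹ ^ 2 = μB b ^ 2`, after cancelling
the common mass of `a` and `a⁻¹`. -/
theorem lamp_isSymm {μA : PMF A} {μB : PMF B} (h : IsSymmPMF (swsMeasure μA μB)) {a : A}
    (ha : a ≠ 1) (haA : μA a ≠ 0) : IsSymmPMF μB := by
  intro b
  have h1 := h (switchElt b * walkElt a * switchElt b)
  have h2 : (switchElt b * walkElt a * switchElt b : restrictedWreath A B)⁻¹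
      = switchElt b⁻¹ * walkElt a⁻¹ * switchElt b⁻¹ := by
    rw [mul_inv_rev, mul_inv_rev, mul_assoc]
    congr 1
    · exact ((switchHom A B).map_inv b).symm
    · congr 1
      · exact ((walkHom A B).map_inv a).symm
      · exact ((switchHom A B).map_inv b).symm
  rw [h2, prob_swsMeasure _ _ (by simpa using ha), prob_swsMeasure _ _ ha, walk_isSymm h a,
    ENNReal.mul_right_inj haA (PMF.apply_ne_top _ _), ← sq, ← sq] at h1
  exact (ENNReal.pow_right_strictMono two_ne_zero).injective h1

theorem mem_support_swsMeasure {μA : PMF A} {μB : PMF B} {a : A} {b b' : B} (ha : a ∈ μA.support)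
    (hb : b ∈ μB.support) (hb' : b' ∈ μB.support) :
    switchElt b * walkElt a * switchElt b' ∈ (swsMeasure μA μB).support := by
  simp only [swsMeasure, pmfConv, PMF.mem_support_bind_iff, PMF.mem_support_map_iff]
  exact ⟨_, ⟨_, ⟨b, hb, rfl⟩, _, ⟨a, ha, rfl⟩, rfl⟩, _, ⟨b', hb', rfl⟩, rfl⟩

theorem walk_support_finite {μA : PMF A} {μB : PMF B} (h : (swsMeasure μA μB).support.Finite) :
    μA.support.Finite := by
  obtain ⟨b, hb⟩ := μB.support_nonempty
  refine (h.image fun g => g.1.right).subset fun a ha => ⟨_, mem_support_swsMeasure ha hb hb, ?_⟩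
  simp [switchElt_right, walkElt_right]

theorem lamp_support_finite {μA : PMF A} {μB : PMF B} (h : (swsMeasure μA μB).support.Finite) :
    μB.support.Finite := by
  obtain ⟨a, ha⟩ := μA.support_nonempty
  obtain ⟨b₀, hb₀⟩ := μB.support_nonempty
  refine Set.Finite.of_finite_image (f := fun b => switchElt b * (walkElt a * switchElt b₀ : restrictedWreath A B))
    (h.subset ?_) ?_
  · rintro _ ⟨b, hb, rfl⟩
    simpa only [mul_assoc] using mem_support_swsMeasure ha hb hb₀
  · intro b _ b' _ hbb
    have := congrArg (fun g => g.1.left 1) (mul_right_cancel hbb)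
    simpa [switchElt_left_one] using this

end Inherit

/-! ### Real-valued averages along a symmetric walk -/

/-- A finitely supported symmetric probability distribution on a group, with real weights. -/
structure SymmSteps (A : Type) [Group A] where
  supp : Finset A
  wt : A → ℝ
  nonneg : ∀ a, 0 ≤ wt a
  sum_one : ∑ a ∈ supp, wt a = 1
  symm : ∀ a, wt a⁻¹ = wt a
  inv_mem : ∀ a ∈ supp, a⁻¹ ∈ supp

namespace SymmSteps

section General

variable {A : Type} [Group A] (P : SymmSteps A)

/-- The average of a real function over one step. -/
def avg (u : A → ℝ) : ℝ := ∑ a ∈ P.supp, P.wt a * u a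

theorem avg_add (u v : A → ℝ) : P.avg (fun a => u a + v a) = P.avg u + P.avg v := by
  simp [avg, mul_add, Finset.sum_add_distrib]

theorem avg_const_mul (c : ℝ) (u : A → ℝ) : P.avg (fun a => c * u a) = c * P.avg u := by
  simp only [avg, Finset.mul_sum]
  exact Finset.sum_congr rfl fun a _ => by ring

theorem avg_sub (u v : A → ℝ) : P.avg (fun a => u a - v a) = P.avg u - P.avg v := by
  simp [avg, mul_sub, Finset.sum_sub_distrib]

theorem avg_const (c : ℝ) : P.avg (fun _ => c) = c := by
  simp [avg, ← Finset.sum_mul, P.sum_one]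

theorem avg_mono {u v : A → ℝ} (h : ∀ a ∈ P.supp, u a ≤ v a) : P.avg u ≤ P.avg v :=
  Finset.sum_le_sum fun a ha => mul_le_mul_of_nonneg_left (h a ha) (P.nonneg a)

theorem avg_le {u : A → ℝ} {c : ℝ} (h : ∀ a ∈ P.supp, u a ≤ c) : P.avg u ≤ c :=
  (P.avg_mono h).trans_eq (P.avg_const c)

theorem avg_nonneg {u : A → ℝ} (h : ∀ a ∈ P.supp, 0 ≤ u a) : 0 ≤ P.avg u :=
  (P.avg_const 0).symm.le.trans (P.avg_mono h)

theorem avg_inv (u : A → ℝ) : P.avg (fun a => u a⁻¹) = P.avg u := by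
  refine Finset.sum_bij' (fun a _ => a⁻¹) (fun a _ => a⁻¹) P.inv_mem P.inv_mem ?_ ?_ ?_ <;>
    simp [P.symm]

/-- The average of a real function of the first `n` steps. -/
def pathAvg : ℕ → (List A → ℝ) → ℝ
  | 0, F => F []
  | n + 1, F => P.avg fun a => pathAvg n fun l => F (a :: l)

theorem pathAvg_succ (n : ℕ) (F : List A → ℝ) :
    P.pathAvg (n + 1) F = P.avg fun a => P.pathAvg n fun l => F (a :: l) := rfl

theorem pathAvg_add (n : ℕ) (F F' : List A → ℝ) :
    P.pathAvg n (fun l => F l + F' l) = P.pathAvg n F + P.pathAvg n F' := by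
  induction n generalizing F F' with
  | zero => rfl
  | succ n ih => simp only [pathAvg_succ, ih, avg_add]

theorem pathAvg_const_mul (n : ℕ) (c : ℝ) (F : List A → ℝ) :
    P.pathAvg n (fun l => c * F l) = c * P.pathAvg n F := by
  induction n generalizing F with
  | zero => rfl
  | succ n ih => simp only [pathAvg_succ, ih, avg_const_mul]

theorem pathAvg_sub (n : ℕ) (F F' : List A → ℝ) :
    P.pathAvg n (fun l => F l - F' l) = P.pathAvg n F - P.pathAvg n F' := by
  induction n generalizing F F' with
  | zero => rfl
  | succ n ih => simp only [pathAvg_succ, ih, avg_sub]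

theorem pathAvg_const (n : ℕ) (c : ℝ) : P.pathAvg n (fun _ => c) = c := by
  induction n with
  | zero => rfl
  | succ n ih => simp only [pathAvg_succ, ih, avg_const]

theorem pathAvg_mono (n : ℕ) {F F' : List A → ℝ} (h : ∀ l, F l ≤ F' l) :
    P.pathAvg n F ≤ P.pathAvg n F' := by
  induction n generalizing F F' with
  | zero => exact h _
  | succ n ih => exact P.avg_mono fun a _ => ih fun l => h _

theorem pathAvg_nonneg (n : ℕ) {F : List A → ℝ} (h : ∀ l, 0 ≤ F l) : 0 ≤ P.pathAvg n F :=
  (P.pathAvg_const n 0).symm.le.trans (P.pathAvg_mono n h)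

theorem pathAvg_sum {ι : Type*} (n : ℕ) (s : Finset ι) (F : ι → List A → ℝ) :
    P.pathAvg n (fun l => ∑ i ∈ s, F i l) = ∑ i ∈ s, P.pathAvg n (F i) := by
  classical
  induction s using Finset.induction_on with
  | empty => simpa using P.pathAvg_const n 0
  | insert i s hi ih => simp only [Finset.sum_insert hi, pathAvg_add, ih]

/-- The sum of `f` over the positions of the walk at times `0, …, n - 1`. -/
def sumAlong (f : A → ℝ) : A → List A → ℝ
  | _, [] => 0
  | x, a :: l => f x + sumAlong f (x * a) l

theorem sumAlong_add (f g : A → ℝ) (x : A) (l : List A) :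
    sumAlong (fun z => f z + g z) x l = sumAlong f x l + sumAlong g x l := by
  induction l generalizing x with
  | nil => simp [sumAlong]
  | cons a l ih => simp only [sumAlong, ih]; ring

theorem sumAlong_sub (f g : A → ℝ) (x : A) (l : List A) :
    sumAlong (fun z => f z - g z) x l = sumAlong f x l - sumAlong g x l := by
  induction l generalizing x with
  | nil => simp [sumAlong]
  | cons a l ih => simp only [sumAlong, ih]; ring

/-- The mean of the sum of `f` along the walk started at `x`. -/
def mean (f : A → ℝ) (n : ℕ) (x : A) : ℝ := P.pathAvg n (sumAlong f x)

theorem mean_zero (f : A → ℝ) (x : A) : P.mean f 0 x = 0 := rfl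

theorem mean_succ (f : A → ℝ) (n : ℕ) (x : A) :
    P.mean f (n + 1) x = f x + P.avg fun a => P.mean f n (x * a) := by
  simp only [mean, pathAvg_succ, sumAlong, pathAvg_add, pathAvg_const, avg_add, avg_const]

theorem mean_sub (f g : A → ℝ) (n : ℕ) (x : A) :
    P.mean (fun z => f z - g z) n x = P.mean f n x - P.mean g n x := by
  simp only [mean, ← pathAvg_sub, ← sumAlong_sub]

theorem mean_add (f g : A → ℝ) (n : ℕ) (x : A) :
    P.mean (fun z => f z + g z) n x = P.mean f n x + P.mean g n x := by
  simp only [mean, ← pathAvg_add, ← sumAlong_add]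

theorem mean_mono {f g : A → ℝ} (h : ∀ z, f z ≤ g z) (n : ℕ) (x : A) :
    P.mean f n x ≤ P.mean g n x := by
  induction n generalizing x with
  | zero => rfl
  | succ n ih =>
    rw [mean_succ, mean_succ]
    exact add_le_add (h x) (P.avg_mono fun a _ => ih _)

theorem mean_nonneg {f : A → ℝ} (h : ∀ z, 0 ≤ f z) (n : ℕ) (x : A) : 0 ≤ P.mean f n x := by
  induction n generalizing x with
  | zero => rfl
  | succ n ih =>
    rw [mean_succ]
    exact add_nonneg (h x) (P.avg_nonneg fun a _ => ih _)

theorem mean_const (c : ℝ) (n : ℕ) (x : A) : P.mean (fun _ => c) n x = n * c := by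
  induction n generalizing x with
  | zero => simp [mean_zero]
  | succ n ih =>
    simp only [mean_succ, ih, avg_const]
    push_cast
    ring

theorem mean_const_mul (c : ℝ) (f : A → ℝ) (n : ℕ) (x : A) :
    P.mean (fun z => c * f z) n x = c * P.mean f n x := by
  induction n generalizing x with
  | zero => simp [mean_zero]
  | succ n ih =>
    simp only [mean_succ, ih, avg_const_mul]
    ring

theorem mean_finset_sum {ι : Type*} (s : Finset ι) (f : ι → A → ℝ) (n : ℕ) (x : A) :
    P.mean (fun z => ∑ i ∈ s, f i z) n x = ∑ i ∈ s, P.mean (f i) n x := by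
  classical
  induction s using Finset.induction_on with
  | empty => simpa using P.mean_const 0 n x
  | insert i s hi ih => simp only [Finset.sum_insert hi, mean_add, ih]

theorem mean_le_succ {f : A → ℝ} (h : ∀ z, 0 ≤ f z) (n : ℕ) (x : A) :
    P.mean f n x ≤ P.mean f (n + 1) x := by
  induction n generalizing x with
  | zero => exact P.mean_nonneg h 1 x
  | succ n ih =>
    rw [mean_succ, mean_succ _ f (n + 1)]
    gcongr
    exact P.avg_mono fun a _ => ih _

theorem pathAvg_sumAlong_sq_succ (f : A → ℝ) (n : ℕ) (x : A) :
    P.pathAvg (n + 1) (fun l => sumAlong f x l ^ 2)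
      = 2 * (f x * P.mean f (n + 1) x) - f x ^ 2
        + P.avg fun a => P.pathAvg n fun l => sumAlong f (x * a) l ^ 2 := by
  have h : ∀ a l, sumAlong f x (a :: l) ^ 2
      = f x ^ 2 + (2 * f x * sumAlong f (x * a) l + sumAlong f (x * a) l ^ 2) := fun a l => by
    simp only [sumAlong]; ring
  simp only [pathAvg_succ, h, pathAvg_add, pathAvg_const, pathAvg_const_mul, avg_add, avg_const,
    avg_const_mul, mean_succ]
  simp only [mean]
  ring

/-- The second moment of an additive functional is controlled by its means at the points where the
functional does not vanish. -/
theorem pathAvg_sumAlong_sq_le (f : A → ℝ) {B : ℝ} (n : ℕ)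
    (h : ∀ k ≤ n, ∀ x, f x * P.mean f k x ≤ B * |f x|) (x : A) :
    P.pathAvg n (fun l => sumAlong f x l ^ 2) ≤ 2 * B * P.mean (fun z => |f z|) n x := by
  induction n generalizing x with
  | zero => simp [pathAvg, sumAlong, mean_zero]
  | succ n ih =>
    rw [pathAvg_sumAlong_sq_succ, P.mean_succ fun z => |f z|]
    have h1 := h (n + 1) le_rfl x
    have h2 := P.avg_mono (u := fun a => P.pathAvg n fun l => sumAlong f (x * a) l ^ 2)
      (v := fun a => 2 * B * P.mean (fun z => |f z|) n (x * a))
      fun a _ => ih (fun k hk => h k (hk.trans n.le_succ)) (x * a)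
    rw [avg_const_mul] at h2
    nlinarith [sq_nonneg (f x)]

/-! ### Truncated Green function and occupation times -/

variable [DecidableEq A]

/-- The indicator function of a point. -/
def pt (y z : A) : ℝ := if z = y then 1 else 0

omit [Group A] in
theorem pt_nonneg (y z : A) : 0 ≤ pt y z := by unfold pt; split_ifs <;> norm_num

/-- The mean number of visits to `y` at times `0, …, n - 1`, started at `x`. -/
def green (n : ℕ) (x y : A) : ℝ := P.mean (pt y) n x

/-- The mean number of returns to the starting point. -/
def ret (n : ℕ) : ℝ := P.green n 1 1

theorem green_nonneg (n : ℕ) (x y : A) : 0 ≤ P.green n x y := P.mean_nonneg (pt_nonneg y) n x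

/-- Visits to `y` are counted only once `y` has been reached, and then less time is left than if the
walk had started there. -/
theorem green_le_diag (n : ℕ) (x y : A) : P.green n x y ≤ P.green n y y := by
  induction n generalizing x with
  | zero => rfl
  | succ n ih =>
    by_cases hx : x = y
    · rw [hx]
    · calc P.green (n + 1) x y = P.avg fun a => P.green n (x * a) y := by
            simp [green, mean_succ, pt, hx]
        _ ≤ P.green n y y := P.avg_le fun a _ => ih _
        _ ≤ P.green (n + 1) y y := P.mean_le_succ (pt_nonneg y) n y

theorem green_mul_left (n : ℕ) (z x y : A) : P.green n (z * x) (z * y) = P.green n x y := by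
  induction n generalizing x with
  | zero => rfl
  | succ n ih =>
    unfold green at ih ⊢
    simp only [mean_succ, mul_assoc, ih]
    simp [pt]

theorem green_self (n : ℕ) (y : A) : P.green n y y = P.ret n := by
  have := P.green_mul_left n y 1 1
  rwa [mul_one] at this

theorem green_le_ret (n : ℕ) (x y : A) : P.green n x y ≤ P.ret n :=
  (P.green_le_diag n x y).trans_eq (P.green_self n y)

theorem ret_le_succ (n : ℕ) : P.ret n ≤ P.ret (n + 1) := P.mean_le_succ (pt_nonneg 1) n 1

theorem ret_mono : Monotone P.ret := monotone_nat_of_le_succ P.ret_le_succ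

/-- The truncated potential kernel is bounded on the support of the step distribution. -/
theorem ret_sub_green_le {a : A} (ha : a ∈ P.supp) (hwt : 0 < P.wt a) (n : ℕ) :
    P.ret n - P.green n a 1 ≤ 1 / P.wt a := by
  have h1 : P.ret (n + 1) = 1 + P.avg fun a => P.green n a 1 := by
    simp [ret, green, mean_succ, pt]
  -- Nonnegative terms whose weighted sum is `1`, so each weighted term is at most `1`.
  have h2 : P.avg (fun a => P.ret (n + 1) - P.green n a 1) = 1 := by
    rw [avg_sub, avg_const, h1]; ring
  have h3 : ∀ a, P.green n a 1 ≤ P.ret (n + 1) := fun a =>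
    (P.green_le_ret n a 1).trans (P.ret_le_succ n)
  have h4 : P.wt a * (P.ret (n + 1) - P.green n a 1) ≤ 1 := by
    rw [← h2]
    exact Finset.single_le_sum
      (f := fun a => P.wt a * (P.ret (n + 1) - P.green n a 1))
      (fun b _ => mul_nonneg (P.nonneg b) (sub_nonneg.2 (h3 b))) ha
  rw [le_div_iff₀ hwt]
  nlinarith [P.ret_le_succ n]

/-- The number of visits to `y` at times `0, …, n - 1`. -/
def occ (x : A) (l : List A) (y : A) : ℝ := sumAlong (pt y) x l

theorem pathAvg_occ_sq_le (n : ℕ) : P.pathAvg n (fun l => occ 1 l 1 ^ 2) ≤ 2 * P.ret n ^ 2 := by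
  have h := P.pathAvg_sumAlong_sq_le (pt 1) (B := P.ret n) n (fun k hk x => by
    rw [abs_of_nonneg (pt_nonneg _ _), mul_comm]
    exact mul_le_mul_of_nonneg_right ((P.green_le_ret k x 1).trans (P.ret_mono hk)) (pt_nonneg _ _)) 1
  simp only [abs_of_nonneg (pt_nonneg _ _)] at h
  calc _ ≤ _ := h
    _ = 2 * P.ret n ^ 2 := by
      change 2 * P.ret n * P.ret n = _
      ring

/-- The functional is the difference of the indicators of `y * a` and `y`; at these two points its
mean is, up to sign, a truncated potential kernel and hence bounded. The variance bound is therefore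
linear in `ret n`, not quadratic: neighbouring sites have nearly equal occupation times. -/
theorem pathAvg_occ_sub_sq_le {a : A} (ha : a ∈ P.supp) (hwt : 0 < P.wt a) (n : ℕ) (y : A) :
    P.pathAvg n (fun l => (occ 1 l (y * a) - occ 1 l y) ^ 2) ≤ 4 * (1 / P.wt a) * P.ret n := by
  set B := 1 / P.wt a with hB
  have hB0 : 0 ≤ B := by positivity
  set f : A → ℝ := fun z => pt (y * a) z - pt y z with hf
  have hmean : ∀ k x, P.mean f k x = P.green k x (y * a) - P.green k x y := fun k x =>
    P.mean_sub _ _ k x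
  have hb : ∀ k, ∀ x, f x * P.mean f k x ≤ B * |f x| := by
    intro k x
    have key : f x ≠ 0 → |P.mean f k x| ≤ B := by
      intro hx
      have hx' : x = y * a ∨ x = y := by
        by_contra! hcon
        simp [hf, pt, hcon.1, hcon.2] at hx
      rcases hx' with rfl | rfl
      · have e : P.green k (y * a) y = P.green k a 1 := by
          simpa using P.green_mul_left k y a 1
        rw [hmean, green_self, e, abs_of_nonneg (sub_nonneg.2 (P.green_le_ret _ _ _))]
        exact P.ret_sub_green_le ha hwt k
      · have e : P.green k x (x * a) = P.green k a⁻¹ 1 := by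
          simpa using (P.green_mul_left k (x * a)⁻¹ x (x * a)).symm
        rw [hmean, green_self, e, abs_sub_comm, abs_of_nonneg (sub_nonneg.2 (P.green_le_ret _ _ _))]
        have := P.ret_sub_green_le (P.inv_mem a ha) (by rwa [P.symm]) k
        rwa [P.symm] at this
    by_cases hx : f x = 0
    · simp [hx]
    · calc f x * P.mean f k x ≤ |f x| * |P.mean f k x| := by
            rw [← abs_mul]; exact le_abs_self _
        _ ≤ |f x| * B := by gcongr; exact key hx
        _ = B * |f x| := mul_comm _ _
  have h := P.pathAvg_sumAlong_sq_le f n (fun k _ => hb k) 1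
  simp only [hf, sumAlong_sub] at h
  refine h.trans ?_
  have h2 : P.mean (fun z => |f z|) n 1 ≤ 2 * P.ret n := by
    calc P.mean (fun z => |f z|) n 1 ≤ P.mean (fun z => pt (y * a) z + pt y z) n 1 :=
          P.mean_mono (fun z => by
            rw [hf]
            refine (abs_sub _ _).trans_eq ?_
            rw [abs_of_nonneg (pt_nonneg _ _), abs_of_nonneg (pt_nonneg _ _)]) n 1
      _ = P.green n 1 (y * a) + P.green n 1 y := P.mean_add _ _ n 1
      _ ≤ 2 * P.ret n := by linarith [P.green_le_ret n 1 (y * a), P.green_le_ret n 1 y]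
  calc _ ≤ 2 * B * (2 * P.ret n) := by gcongr
    _ = _ := by ring

/-- Telescoping over `1, a, …, a ^ k` and Cauchy–Schwarz. -/
theorem pathAvg_occ_pow_sub_sq_le {a : A} (ha : a ∈ P.supp) (hwt : 0 < P.wt a) (n k : ℕ) :
    P.pathAvg n (fun l => (occ 1 l (a ^ k) - occ 1 l 1) ^ 2)
      ≤ k ^ 2 * (4 * (1 / P.wt a) * P.ret n) := by
  have h1 : ∀ l : List A, (occ 1 l (a ^ k) - occ 1 l 1) ^ 2
      ≤ k * ∑ i ∈ Finset.range k, (occ 1 l (a ^ i * a) - occ 1 l (a ^ i)) ^ 2 := by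
    intro l
    have e : occ 1 l (a ^ k) - occ 1 l 1
        = ∑ i ∈ Finset.range k, (occ 1 l (a ^ i * a) - occ 1 l (a ^ i)) := by
      simp only [← pow_succ]
      rw [Finset.sum_range_sub (fun i => occ 1 l (a ^ i)), pow_zero]
    rw [e]
    simpa using sq_sum_le_card_mul_sum_sq (s := Finset.range k)
      (f := fun i => occ 1 l (a ^ i * a) - occ 1 l (a ^ i))
  refine (P.pathAvg_mono n h1).trans ?_
  rw [pathAvg_const_mul, pathAvg_sum]
  calc (k : ℝ) * ∑ i ∈ Finset.range k, _
      ≤ k * ∑ i ∈ Finset.range k, 4 * (1 / P.wt a) * P.ret n := by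
        gcongr with i
        exact P.pathAvg_occ_sub_sq_le ha hwt n _
    _ = _ := by
      rw [Finset.sum_const, Finset.card_range, nsmul_eq_mul]; ring

/-- Each step switches at both of its ends, so every position is counted twice except the first and
the last. -/
theorem visitCount_eq (x : A) (l : List A) (y : A) :
    (visitCount x l y : ℝ) + pt y x = 2 * occ x l y + pt y (x * l.prod) := by
  induction l generalizing x with
  | nil => simp [visitCount, occ, sumAlong]
  | cons a l ih =>
    have := ih (x * a)
    simp only [visitCount, occ, sumAlong, List.prod_cons, ← mul_assoc] at this ⊢
    push_cast
    simp only [pt] at this ⊢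
    linarith

theorem le_visitCount (l : List A) (y : A) : 2 * occ 1 l y - 1 ≤ visitCount 1 l y := by
  have h := visitCount_eq 1 l y
  have h1 : pt y 1 ≤ 1 := by unfold pt; split_ifs <;> norm_num
  linarith [pt_nonneg y (1 * l.prod)]

theorem visitCount_le (l : List A) (y : A) : visitCount 1 l y ≤ 2 * occ 1 l y + 1 := by
  have h := visitCount_eq 1 l y
  have h1 : pt y (1 * l.prod) ≤ 1 := by unfold pt; split_ifs <;> norm_num
  linarith [pt_nonneg y 1]

/-- With probability bounded below, the numbers of visits to `1, a, …, a ^ (w - 1)` are all comparable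
with the mean number of returns. -/
theorem pathAvg_visitCount_ge {a : A} (ha : a ∈ P.supp) (hwt : 0 < P.wt a) {n w : ℕ}
    (hn : 4 ≤ P.ret n) (hw : 2048 * (1 / P.wt a) * (w : ℝ) ^ 3 ≤ P.ret n) {S : Set (List A)}
    (hS : ∀ l, (∀ k < w, P.ret n / 4 ≤ visitCount 1 l (a ^ k) ∧
      (visitCount 1 l (a ^ k) : ℝ) ≤ 35 * P.ret n) → l ∈ S) :
    1 / 32 ≤ P.pathAvg n (S.indicator 1) := by
  set u := P.ret n with hu
  have hu0 : 0 < u := by linarith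
  set ℓ : List A → ℝ := fun l => occ 1 l 1 with hℓ
  set D : List A → ℝ := fun l => ∑ k ∈ Finset.range w, (occ 1 l (a ^ k) - occ 1 l 1) ^ 2 with hD
  have hℓ0 : ∀ l, 0 ≤ ℓ l := by
    intro l
    have : ∀ x : A, 0 ≤ sumAlong (pt 1) x l := by
      induction l with
      | nil => simp [sumAlong]
      | cons b l ih => exact fun x => add_nonneg (pt_nonneg _ _) (ih _)
    exact this 1
  have hD0 : ∀ l, 0 ≤ D l := fun l => Finset.sum_nonneg fun _ _ => sq_nonneg _
  -- With `t = ℓ / u`, the quadratic `7 t / 16 - 1 / 4 - t ^ 2 / 16` is less than `1` everywhere and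
  -- negative for `t < 1 / 2` and `t > 16`. The mean of `t` is `1` and that of `t ^ 2` at most `2`,
  -- so averaging leaves at least `7/16 - 1/4 - 1/8 - 1/32 = 1/32`.
  have hpt : ∀ l, (7 / (16 * u)) * ℓ l - 1 / 4 - (1 / (16 * u ^ 2)) * ℓ l ^ 2
      - (16 / u ^ 2) * D l ≤ S.indicator 1 l := by
    intro l
    have hDu : 0 ≤ (16 / u ^ 2) * D l := mul_nonneg (by positivity) (hD0 l)
    set t := ℓ l / u with ht
    have ht0 : 0 ≤ t := div_nonneg (hℓ0 l) hu0.le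
    have e1 : (7 / (16 * u)) * ℓ l = 7 / 16 * t := by rw [ht]; field_simp
    have e2 : (1 / (16 * u ^ 2)) * ℓ l ^ 2 = 1 / 16 * t ^ 2 := by rw [ht]; field_simp
    rw [e1, e2]
    by_cases hl : l ∈ S
    · simp only [Set.indicator_of_mem hl, Pi.one_apply]
      nlinarith [sq_nonneg (t - 7 / 2)]
    · simp only [Set.indicator_of_notMem hl]
      have hex : t < 1 / 2 ∨ 16 < t ∨ 1 ≤ (16 / u ^ 2) * D l := by
        by_contra! hcon
        obtain ⟨h1, h2, h3⟩ := hcon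
        refine hl (hS l fun k hk => ?_)
        have h4 : (occ 1 l (a ^ k) - ℓ l) ^ 2 ≤ D l :=
          Finset.single_le_sum (f := fun k => (occ 1 l (a ^ k) - occ 1 l 1) ^ 2)
            (fun _ _ => sq_nonneg _) (Finset.mem_range.2 hk)
        have h5 : D l ≤ (u / 4) ^ 2 := by
          rw [div_mul_eq_mul_div, div_lt_one (by positivity)] at h3
          linarith
        have h6 := abs_le_of_sq_le_sq' (h4.trans h5) (by positivity)
        have h7 : u / 2 ≤ ℓ l := by
          rw [ht, le_div_iff₀ hu0] at h1; linarith
        have h8 : ℓ l ≤ 16 * u := by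
          rwa [ht, div_le_iff₀ hu0] at h2
        constructor
        · linarith [le_visitCount l (a ^ k)]
        · linarith [visitCount_le l (a ^ k)]
      rcases hex with h | h | h
      · nlinarith [sq_nonneg t]
      · nlinarith [sq_nonneg t]
      · nlinarith [sq_nonneg (t - 7 / 2)]
  have hDavg : P.pathAvg n D ≤ 4 * (1 / P.wt a) * (w : ℝ) ^ 3 * u := by
    simp only [hD]
    rw [pathAvg_sum]
    calc _ ≤ ∑ k ∈ Finset.range w, (w : ℝ) ^ 2 * (4 * (1 / P.wt a) * u) := by
          refine Finset.sum_le_sum fun k hk => (P.pathAvg_occ_pow_sub_sq_le ha hwt n k).trans ?_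
          have : (k : ℝ) ≤ w := by exact_mod_cast (Finset.mem_range.1 hk).le
          gcongr
      _ = _ := by rw [Finset.sum_const, Finset.card_range, nsmul_eq_mul]; ring
  have h := P.pathAvg_mono n hpt
  simp only [pathAvg_sub, pathAvg_const_mul, pathAvg_const] at h
  have h1 : P.pathAvg n ℓ = u := rfl
  have h2 : P.pathAvg n (fun l => ℓ l ^ 2) ≤ 2 * u ^ 2 := P.pathAvg_occ_sq_le n
  have h3 : (1 / (16 * u ^ 2)) * P.pathAvg n (fun l => ℓ l ^ 2) ≤ 1 / 8 := by
    calc _ ≤ (1 / (16 * u ^ 2)) * (2 * u ^ 2) := by gcongr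
      _ = 1 / 8 := by field_simp; norm_num
  have h4 : (16 / u ^ 2) * P.pathAvg n D ≤ 1 / 32 := by
    calc _ ≤ (16 / u ^ 2) * (4 * (1 / P.wt a) * (w : ℝ) ^ 3 * u) := by gcongr
      _ = (64 * (1 / P.wt a) * (w : ℝ) ^ 3) / u := by field_simp; ring
      _ ≤ 1 / 32 := by
        rw [div_le_iff₀ hu0]
        linarith
  have h5 : (7 / (16 * u)) * P.pathAvg n ℓ = 7 / 16 := by rw [h1]; field_simp
  linarith

end General

/-! ### Occupation times of walks on the integers are of order `√n` -/

section Integers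

open Multiplicative

/-- The integer underlying an element of `Multiplicative ℤ`, as a real number. -/
def pos (x : Multiplicative ℤ) : ℝ := (toAdd x : ℤ)

theorem pos_mul (x y : Multiplicative ℤ) : pos (x * y) = pos x + pos y := by simp [pos]

theorem pos_one : pos 1 = 0 := by simp [pos]

theorem pos_inv (x : Multiplicative ℤ) : pos x⁻¹ = -pos x := by simp [pos]

variable (P : SymmSteps (Multiplicative ℤ)) {b : ℝ}

theorem avg_pos : P.avg (fun a => pos a) = 0 := by
  have h := P.avg_inv fun a => pos a
  have h2 := P.avg_const_mul (-1) fun a => pos a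
  simp only [pos_inv, neg_mul, one_mul] at h h2
  linarith

theorem avg_pos_sq_le (hb : ∀ a ∈ P.supp, |pos a| ≤ b) :
    P.avg (fun a => pos a ^ 2) ≤ b ^ 2 :=
  P.avg_le fun a ha => sq_le_sq' (abs_le.1 (hb a ha)).1 (abs_le.1 (hb a ha)).2

theorem mean_sq_le (hb : ∀ a ∈ P.supp, |pos a| ≤ b) (n : ℕ) (x : Multiplicative ℤ) :
    P.mean (fun z => pos z ^ 2) n x ≤ n * pos x ^ 2 + b ^ 2 * n ^ 2 := by
  induction n generalizing x with
  | zero => simp [mean_zero]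
  | succ n ih =>
    rw [mean_succ]
    have h1 := P.avg_mono fun a _ => ih (x * a)
    have h2 : ∀ a : Multiplicative ℤ, (n : ℝ) * pos (x * a) ^ 2 + b ^ 2 * n ^ 2
        = (n * pos x ^ 2 + b ^ 2 * n ^ 2)
          + (2 * n * pos x * pos a + n * pos a ^ 2) := by
      intro a; rw [pos_mul]; ring
    simp only [h2, avg_add, avg_const, avg_const_mul, avg_pos] at h1
    have h3 := mul_le_mul_of_nonneg_left (P.avg_pos_sq_le hb) (Nat.cast_nonneg (α := ℝ) n)
    push_cast
    nlinarith [mul_nonneg (sq_nonneg b) (Nat.cast_nonneg (α := ℝ) n), sq_nonneg b]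

theorem pathAvg_endpoint_sq_le (hb : ∀ a ∈ P.supp, |pos a| ≤ b) (n : ℕ)
    (x : Multiplicative ℤ) :
    P.pathAvg n (fun l => pos (x * l.prod) ^ 2) ≤ pos x ^ 2 + b ^ 2 * n := by
  induction n generalizing x with
  | zero => simp [pathAvg]
  | succ n ih =>
    simp only [pathAvg_succ, List.prod_cons, ← mul_assoc]
    have h1 := P.avg_mono fun a _ => ih (x * a)
    have h2 : ∀ a : Multiplicative ℤ, pos (x * a) ^ 2 + b ^ 2 * n
        = (pos x ^ 2 + b ^ 2 * n) + (2 * pos x * pos a + pos a ^ 2) := by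
      intro a; rw [pos_mul]; ring
    simp only [h2, avg_add, avg_const, avg_const_mul, avg_pos] at h1
    have h3 := P.avg_pos_sq_le hb
    push_cast
    linarith

/-- A discrete Tanaka inequality: the distance from `0` is a submartingale, and each visit to `0`
adds the mean absolute step. -/
theorem le_pathAvg_endpoint_abs (n : ℕ) (x : Multiplicative ℤ) :
    |pos x| + P.avg (fun a => |pos a|) * P.green n x 1
      ≤ P.pathAvg n (fun l => |pos (x * l.prod)|) := by
  induction n generalizing x with
  | zero => simp [pathAvg, green, mean_zero]
  | succ n ih =>
    simp only [pathAvg_succ, List.prod_cons, ← mul_assoc]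
    refine le_trans ?_ (P.avg_mono fun a _ => ih (x * a))
    rw [avg_add, avg_const_mul, green, mean_succ]
    simp only [green]
    have key : |pos x| + P.avg (fun a => |pos a|) * pt 1 x
        ≤ P.avg fun a => |pos (x * a)| := by
      by_cases hx : x = 1
      · simp [hx, pt, pos_one]
      · rw [pt, if_neg hx, mul_zero, add_zero]
        calc |pos x| = |P.avg fun a => pos (x * a)| := by
              have : ∀ a : Multiplicative ℤ, pos (x * a) = pos x + pos a := by
                intro a; rw [pos_mul]
              simp only [this, avg_add, avg_const, avg_pos, add_zero]
          _ ≤ P.avg fun a => |pos (x * a)| := by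
              refine (Finset.abs_sum_le_sum_abs _ _).trans_eq (Finset.sum_congr rfl fun a _ => ?_)
              rw [abs_mul, abs_of_nonneg (P.nonneg a)]
    linarith

/-- The Tanaka inequality at `x = 1`, with the mean distance bounded through the second moment. -/
theorem ret_le_sqrt (hb : ∀ a ∈ P.supp, |pos a| ≤ b) (hb0 : 0 < b) (n : ℕ) :
    P.avg (fun a => |pos a|) * P.ret n ≤ b * √n := by
  rcases Nat.eq_zero_or_pos n with rfl | hn
  · simp [ret, green, mean_zero]
  have hn' : (0 : ℝ) < √n := Real.sqrt_pos.2 (by exact_mod_cast hn)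
  have h1 := P.le_pathAvg_endpoint_abs n 1
  have h2 := P.pathAvg_endpoint_sq_le hb n 1
  simp only [one_mul, pos_one, abs_zero, zero_add, ne_eq, OfNat.ofNat_ne_zero,
    not_false_eq_true, zero_pow] at h1 h2
  refine h1.trans ?_
  set M := b * √n with hM
  have hM0 : 0 < M := by positivity
  have h3 : ∀ l : List (Multiplicative ℤ), |pos l.prod|
      ≤ (1 / (2 * M)) * pos l.prod ^ 2 + M / 2 := by
    intro l
    rw [← sq_abs (pos l.prod), ← sub_nonneg]
    have : (1 / (2 * M)) * |pos l.prod| ^ 2 + M / 2 - |pos l.prod|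
        = (|pos l.prod| - M) ^ 2 / (2 * M) := by field_simp; ring
    rw [this]; positivity
  refine (P.pathAvg_mono n h3).trans ?_
  rw [pathAvg_add, pathAvg_const_mul, pathAvg_const]
  have h4 : b ^ 2 * n = M ^ 2 := by rw [hM, mul_pow, Real.sq_sqrt (by positivity)]
  calc _ ≤ 1 / (2 * M) * M ^ 2 + M / 2 := by gcongr; rw [← h4]; exact h2
    _ = M := by field_simp; ring

/-- By Chebyshev the walk spends on average at least three quarters of its time within `r` of `0`,
where `r` is about `2 b √n`, and no site receives more than `ret n` visits on average. -/
theorem sqrt_le_ret (hb : ∀ a ∈ P.supp, |pos a| ≤ b) (hb1 : 1 ≤ b) (n : ℕ) :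
    √n / (10 * b) ≤ P.ret n := by
  rcases Nat.eq_zero_or_pos n with rfl | hn
  · simp [ret, green, mean_zero]
  have hn' : (1 : ℝ) ≤ √n := Real.one_le_sqrt.2 (by exact_mod_cast hn)
  have hsq : √(n : ℝ) ^ 2 = n := Real.sq_sqrt (by positivity)
  obtain ⟨r, hr1, hr2⟩ : ∃ r : ℕ, 2 * b * √n ≤ r ∧ (r : ℝ) ≤ 2 * b * √n + 1 :=
    ⟨_, Nat.le_ceil _, (Nat.ceil_lt_add_one (by positivity)).le⟩
  have hr0 : (0 : ℝ) < r := lt_of_lt_of_le (by positivity) hr1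
  set Y : Finset (Multiplicative ℤ) := (Finset.Icc (-(r : ℤ)) r).map ofAdd.toEmbedding with hY
  have hcard : (Y.card : ℝ) = 2 * r + 1 := by
    have : Y.card = 2 * r + 1 := by simp [hY]; omega
    rw [this]; push_cast; ring
  have h1 : ∀ z : Multiplicative ℤ, 1 - (1 / (r : ℝ) ^ 2) * pos z ^ 2 ≤ ∑ y ∈ Y, pt y z := by
    intro z
    by_cases hz : z ∈ Y
    · have : ∑ y ∈ Y, pt y z = 1 := by simp [pt, hz]
      rw [this]
      have : 0 ≤ (1 / (r : ℝ) ^ 2) * pos z ^ 2 := by positivity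
      linarith
    · refine le_trans ?_ (Finset.sum_nonneg fun y _ => pt_nonneg y z)
      have hz' : (r : ℝ) ≤ |pos z| := by
        have : ¬ (-(r : ℤ) ≤ toAdd z ∧ toAdd z ≤ r) := by
          intro hcon
          exact hz (Finset.mem_map.2 ⟨toAdd z, Finset.mem_Icc.2 hcon, rfl⟩)
        rw [← abs_le, not_le] at this
        unfold pos; exact_mod_cast this.le
      have : (r : ℝ) ^ 2 ≤ pos z ^ 2 := by rw [← sq_abs (pos z)]; gcongr
      rw [sub_nonpos, div_mul_eq_mul_div, one_mul, le_div_iff₀ (by positivity)]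
      linarith
  have h2 := P.mean_mono h1 n 1
  rw [mean_sub, mean_const, mean_const_mul, mean_finset_sum] at h2
  have h3 : ∑ y ∈ Y, P.mean (pt y) n 1 ≤ (2 * r + 1) * P.ret n := by
    rw [← hcard, ← nsmul_eq_mul]
    exact Finset.sum_le_card_nsmul _ _ _ fun y _ => P.green_le_ret n 1 y
  have h4 : (1 / (r : ℝ) ^ 2) * P.mean (fun z => pos z ^ 2) n 1 ≤ n / 4 := by
    have h5 := P.mean_sq_le hb n 1
    simp only [pos_one] at h5
    have h6 : (2 * b * √n) ^ 2 ≤ (r : ℝ) ^ 2 := by gcongr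
    rw [mul_pow, hsq] at h6
    rw [div_mul_eq_mul_div, one_mul, div_le_iff₀ (by positivity)]
    nlinarith [Nat.cast_nonneg (α := ℝ) n]
  have hret : 0 ≤ P.ret n := P.green_nonneg n 1 1
  have h7 : (2 * r + 1) * P.ret n ≤ (7 * (b * √n)) * P.ret n := by
    have : 1 ≤ b * √n := one_le_mul_of_one_le_of_one_le hb1 hn'
    gcongr
    linarith
  have h8 : (3 / 4 : ℝ) * √n * √n ≤ (7 * b * P.ret n) * √n := by
    rw [mul_assoc, ← sq, hsq]
    linarith
  have h9 := le_of_mul_le_mul_right h8 (by positivity)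
  rw [div_le_iff₀ (by positivity)]
  nlinarith

/-- With probability bounded below, the lamps at `1, a, …, a ^ (w - 1)` have all been switched about
`√n` times. -/
theorem exists_pathAvg_visitCount_ge {a : Multiplicative ℤ} (ha : a ∈ P.supp) (hwt : 0 < P.wt a)
    (ha1 : a ≠ 1) :
    ∃ c C D : ℝ, 0 < c ∧ 0 < C ∧ ∀ (n w : ℕ), D * ((w : ℝ) ^ 3 + 1) ≤ √n →
      1 / 32 ≤ P.pathAvg n ({l | ∀ k < w, c * √n ≤ visitCount 1 l (a ^ k) ∧
        (visitCount 1 l (a ^ k) : ℝ) ≤ C * √n}.indicator 1) := by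
  obtain ⟨b, hb1, hb⟩ : ∃ b : ℝ, 1 ≤ b ∧ ∀ a ∈ P.supp, |pos a| ≤ b := by
    refine ⟨1 + ∑ a ∈ P.supp, |pos a|, ?_, fun a ha => ?_⟩
    · linarith [Finset.sum_nonneg fun (a : Multiplicative ℤ) (_ : a ∈ P.supp) =>
        abs_nonneg (pos a)]
    · linarith [Finset.single_le_sum (f := fun a : Multiplicative ℤ => |pos a|)
        (fun a _ => abs_nonneg _) ha]
  set κ := P.avg (fun a => |pos a|) with hκ
  have hκ0 : 0 < κ := by
    have h1 : P.wt a * |pos a| ≤ κ :=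
      Finset.single_le_sum (f := fun a => P.wt a * |pos a|)
        (fun a _ => mul_nonneg (P.nonneg a) (abs_nonneg _)) ha
    have h2 : (0 : ℝ) < |pos a| := abs_pos.2 (by
      have : toAdd a ≠ 0 := fun h => ha1 (toAdd_eq_zero.1 h)
      unfold pos; exact_mod_cast this)
    exact (mul_pos hwt h2).trans_le h1
  refine ⟨1 / (40 * b), 35 * (b / κ), 10 * b * (2048 * (1 / P.wt a) + 4), by positivity,
    by positivity, fun n w hD => ?_⟩
  have hlow := P.sqrt_le_ret hb hb1 n
  have hup : P.ret n ≤ b / κ * √n := by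
    rw [div_mul_eq_mul_div, le_div_iff₀ hκ0, mul_comm]
    exact P.ret_le_sqrt hb (by linarith) n
  have hD' : (2048 * (1 / P.wt a) + 4) * ((w : ℝ) ^ 3 + 1) ≤ P.ret n := by
    refine le_trans ?_ hlow
    rw [le_div_iff₀ (by positivity)]
    linarith
  have hw3 : (0 : ℝ) ≤ (w : ℝ) ^ 3 := by positivity
  have hp : 0 < 1 / P.wt a := by positivity
  have hpw : 0 ≤ 1 / P.wt a * (w : ℝ) ^ 3 := by positivity
  have hbig : 4 ≤ P.ret n ∧ 2048 * (1 / P.wt a) * (w : ℝ) ^ 3 ≤ P.ret n := by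
    generalize 1 / P.wt a = q at *
    constructor <;> nlinarith
  refine P.pathAvg_visitCount_ge ha hwt hbig.1 hbig.2 fun l hl k hk => ?_
  obtain ⟨h1, h2⟩ := hl k hk
  constructor
  · refine le_trans ?_ h1
    have : 1 / (40 * b) * √n = √n / (10 * b) / 4 := by field_simp; ring
    rw [this]
    linarith
  · nlinarith

end Integers

/-! ### From probability mass functions to real averages -/

section OfPMF

variable {A : Type} [Group A]

/-- The weights of a finitely supported symmetric probability mass function. -/
noncomputable def ofPMF (μ : PMF A) (hfin : μ.support.Finite) (hμ : IsSymmPMF μ) : SymmSteps A where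
  supp := hfin.toFinset
  wt a := (μ a).toReal
  nonneg _ := ENNReal.toReal_nonneg
  sum_one := by
    rw [← ENNReal.toReal_sum fun a _ => PMF.apply_ne_top μ a, ← tsum_eq_sum (L := SummationFilter.unconditional A), μ.tsum_coe,
      ENNReal.toReal_one]
    intro a ha
    rwa [Set.Finite.mem_toFinset, ← PMF.apply_eq_zero_iff] at ha
  symm a := by rw [hμ a]
  inv_mem a ha := by
    rw [Set.Finite.mem_toFinset, PMF.mem_support_iff] at ha ⊢
    rwa [hμ a]

variable {μ : PMF A} (hfin : μ.support.Finite) (hμ : IsSymmPMF μ)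

theorem expect_ofReal {u : A → ℝ} (hu : ∀ a, 0 ≤ u a) :
    expect μ (fun a => ENNReal.ofReal (u a)) = ENNReal.ofReal ((ofPMF μ hfin hμ).avg u) := by
  rw [expect, tsum_eq_sum (s := hfin.toFinset), avg, ENNReal.ofReal_sum_of_nonneg]
  · refine Finset.sum_congr rfl fun a _ => ?_
    change _ = ENNReal.ofReal ((μ a).toReal * u a)
    rw [ENNReal.ofReal_mul ENNReal.toReal_nonneg, ENNReal.ofReal_toReal (PMF.apply_ne_top μ a)]
  · exact fun a _ => mul_nonneg ENNReal.toReal_nonneg (hu a)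
  · intro a ha
    have : μ a = 0 := by
      rwa [Set.Finite.mem_toFinset, ← PMF.apply_eq_zero_iff] at ha
    rw [this, zero_mul]

theorem expect_pathLaw_ofReal (n : ℕ) {F : List A → ℝ} (hF : ∀ l, 0 ≤ F l) :
    expect (pathLaw μ n) (fun l => ENNReal.ofReal (F l))
      = ENNReal.ofReal ((ofPMF μ hfin hμ).pathAvg n F) := by
  induction n generalizing F with
  | zero => simp [pathLaw, expect_pure, pathAvg]
  | succ n ih =>
    rw [expect_pathLaw_succ, pathAvg_succ, ← expect_ofReal hfin hμ]
    · exact expect_congr μ fun a _ => ih fun l => hF _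
    · exact fun a => pathAvg_nonneg _ _ fun l => hF _

theorem expect_convPow_ofReal (n : ℕ) {u : A → ℝ} (hu : ∀ l, 0 ≤ u l) :
    expect (convPow μ n) (fun x => ENNReal.ofReal (u x))
      = ENNReal.ofReal ((ofPMF μ hfin hμ).pathAvg n fun l => u l.prod) := by
  induction n generalizing u with
  | zero => simp [convPow, expect_pure, pathAvg]
  | succ n ih =>
    rw [expect_convPow_succ', pathAvg_succ, ← expect_ofReal hfin hμ]
    · refine expect_congr μ fun a _ => ?_
      simp only [List.prod_cons]
      exact ih fun l => hu _
    · exact fun a => pathAvg_nonneg _ _ fun l => hu _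

theorem prob_pathLaw_eq (n : ℕ) (S : Set (List A)) :
    prob (pathLaw μ n) S = ENNReal.ofReal ((ofPMF μ hfin hμ).pathAvg n (S.indicator 1)) := by
  rw [← expect_pathLaw_ofReal]
  · refine expect_congr _ fun l _ => ?_
    by_cases hl : l ∈ S <;> simp [hl]
  · exact fun l => Set.indicator_nonneg (fun _ _ => zero_le_one) l

theorem prob_convPow_eq (n : ℕ) (S : Set A) :
    prob (convPow μ n) S
      = ENNReal.ofReal ((ofPMF μ hfin hμ).pathAvg n fun l => S.indicator 1 l.prod) := by
  rw [← expect_convPow_ofReal]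
  · refine expect_congr _ fun l _ => ?_
    by_cases hl : l ∈ S <;> simp [hl]
  · exact fun l => Set.indicator_nonneg (fun _ _ => zero_le_one) l

end OfPMF

end SymmSteps

/-! ### Tails of symmetric walks on the integers -/

namespace SymmSteps

section Tail

open Multiplicative

variable (P : SymmSteps (Multiplicative ℤ))

/-- The mean of `u` at the position at time `n` of the walk on `ℤ` started at the real number `x`. -/
def walkAvg (n : ℕ) (u : ℝ → ℝ) (x : ℝ) : ℝ := P.pathAvg n fun l => u (x + pos l.prod)

theorem walkAvg_zero (u : ℝ → ℝ) (x : ℝ) : P.walkAvg 0 u x = u x := by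
  simp [walkAvg, pathAvg, pos_one]

theorem walkAvg_succ (n : ℕ) (u : ℝ → ℝ) (x : ℝ) :
    P.walkAvg (n + 1) u x = P.avg fun a => P.walkAvg n u (x + pos a) := by
  simp only [walkAvg, pathAvg_succ, List.prod_cons, pos_mul, add_assoc]

theorem walkAvg_add_time (m n : ℕ) (u : ℝ → ℝ) (x : ℝ) :
    P.walkAvg (m + n) u x = P.walkAvg m (P.walkAvg n u) x := by
  induction m generalizing x with
  | zero => rw [zero_add, walkAvg_zero]
  | succ m ih => simp only [Nat.add_right_comm m 1 n, walkAvg_succ, ih]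

theorem walkAvg_succ' (n : ℕ) (u : ℝ → ℝ) (x : ℝ) :
    P.walkAvg (n + 1) u x = P.walkAvg n (fun z => P.avg fun a => u (z + pos a)) x := by
  rw [walkAvg_add_time]
  congr 1
  funext z
  rw [← zero_add 1, walkAvg_succ]
  simp only [walkAvg_zero]

theorem walkAvg_add (n : ℕ) (u v : ℝ → ℝ) (x : ℝ) :
    P.walkAvg n (fun z => u z + v z) x = P.walkAvg n u x + P.walkAvg n v x :=
  P.pathAvg_add n _ _

theorem walkAvg_sub (n : ℕ) (u v : ℝ → ℝ) (x : ℝ) :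
    P.walkAvg n (fun z => u z - v z) x = P.walkAvg n u x - P.walkAvg n v x :=
  P.pathAvg_sub n _ _

theorem walkAvg_const_mul (n : ℕ) (c : ℝ) (u : ℝ → ℝ) (x : ℝ) :
    P.walkAvg n (fun z => c * u z) x = c * P.walkAvg n u x :=
  P.pathAvg_const_mul n c _

theorem walkAvg_const (n : ℕ) (c x : ℝ) : P.walkAvg n (fun _ => c) x = c :=
  P.pathAvg_const n c

theorem walkAvg_mono (n : ℕ) {u v : ℝ → ℝ} (h : ∀ z, u z ≤ v z) (x : ℝ) :
    P.walkAvg n u x ≤ P.walkAvg n v x :=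
  P.pathAvg_mono n fun _ => h _

theorem walkAvg_comp_add (n : ℕ) (u : ℝ → ℝ) (c x : ℝ) :
    P.walkAvg n (fun z => u (z + c)) x = P.walkAvg n u (x + c) := by
  simp only [walkAvg, add_right_comm]

theorem walkAvg_avg (n : ℕ) (w : Multiplicative ℤ → ℝ) (u : Multiplicative ℤ → ℝ → ℝ) (x : ℝ) :
    P.walkAvg n (fun z => P.avg fun a => w a * u a z) x
      = P.avg fun a => w a * P.walkAvg n (u a) x := by
  simp only [walkAvg, avg]
  rw [pathAvg_sum]
  refine Finset.sum_congr rfl fun a _ => ?_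
  rw [pathAvg_const_mul, pathAvg_const_mul]

theorem walkAvg_neg (n : ℕ) (u : ℝ → ℝ) (x : ℝ) :
    P.walkAvg n (fun z => u (-z)) x = P.walkAvg n u (-x) := by
  induction n generalizing x with
  | zero => simp only [walkAvg_zero]
  | succ n ih =>
    rw [walkAvg_succ, walkAvg_succ, ← avg_inv]
    simp only [ih, pos_inv, neg_add, neg_neg]

/-- The `n + 1` steps contribute equally to the mean of the displacement times a function of the
endpoint. -/
theorem walkAvg_displacement_mul (n : ℕ) (g : ℝ → ℝ) (x : ℝ) :
    P.walkAvg (n + 1) (fun z => (z - x) * g z) x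
      = (n + 1) * P.walkAvg n (fun z => P.avg fun a => pos a * g (z + pos a)) x := by
  induction n generalizing x with
  | zero => simp [walkAvg_succ, walkAvg_zero]
  | succ n ih =>
    have h1 : ∀ a, P.walkAvg (n + 1) (fun z => (z - x) * g z) (x + pos a)
        = (n + 1) * P.walkAvg n (fun z => P.avg fun a => pos a * g (z + pos a)) (x + pos a)
          + pos a * P.walkAvg (n + 1) g (x + pos a) := by
      intro a
      rw [← ih, ← walkAvg_const_mul, ← walkAvg_add]
      congr 1
      funext z
      ring
    rw [walkAvg_succ]
    simp only [h1, avg_add, avg_const_mul, ← walkAvg_succ]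
    have h2 : P.walkAvg (n + 1) (fun z => P.avg fun a => pos a * g (z + pos a)) x
        = P.avg fun a => pos a * P.walkAvg (n + 1) g (x + pos a) := by
      rw [P.walkAvg_avg (n + 1) pos fun a z => g (z + pos a)]
      simp only [walkAvg_comp_add]
    rw [← h2]
    push_cast
    ring

/-- The indicator function of `[t, ∞)`. -/
noncomputable def step (t z : ℝ) : ℝ := if t ≤ z then 1 else 0

theorem step_nonneg (t z : ℝ) : 0 ≤ step t z := by unfold step; split_ifs <;> norm_num

theorem step_le_one (t z : ℝ) : step t z ≤ 1 := by unfold step; split_ifs <;> norm_num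

/-- The probability that the walk on `ℤ` started at `0` is at least `t` at time `n`. -/
noncomputable def tail (n : ℕ) (t : ℝ) : ℝ := P.walkAvg n (step t) 0

theorem tail_nonneg (n : ℕ) (t : ℝ) : 0 ≤ P.tail n t :=
  P.pathAvg_nonneg n fun _ => step_nonneg _ _

theorem tail_le_one (n : ℕ) (t : ℝ) : P.tail n t ≤ 1 :=
  (P.walkAvg_mono n (step_le_one t) 0).trans_eq (P.walkAvg_const n 1 0)

theorem tail_anti (n : ℕ) : Antitone (P.tail n) := by
  intro s t hst
  refine P.walkAvg_mono n (fun z => ?_) 0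
  unfold step
  split_ifs <;> linarith

/-- The left side is at most the mean of the endpoint on the event that it is at least `t`. All
steps contribute equally to that mean, and after symmetrisation a step contributes only when the
walk ends in `[t, t + 2 b)`. Iterating this in `t` gives the decay of the tail with no local limit
theorem. -/
theorem mul_tail_le {b : ℝ} (hb : ∀ a ∈ P.supp, |pos a| ≤ b) (n : ℕ) (t : ℝ) :
    t * P.tail n t ≤ n * b * (P.tail n t - P.tail n (t + 2 * b)) := by
  cases n with
  | zero =>
    simp only [tail, walkAvg_zero, step, Nat.cast_zero, zero_mul]
    split_ifs <;> linarith
  | succ n =>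
    have h1 : t * P.tail (n + 1) t ≤ P.walkAvg (n + 1) (fun z => (z - 0) * step t z) 0 := by
      rw [tail, ← walkAvg_const_mul]
      refine P.walkAvg_mono _ (fun z => ?_) 0
      unfold step
      split_ifs <;> linarith
    rw [walkAvg_displacement_mul] at h1
    refine h1.trans ?_
    -- Pair `a` with `a⁻¹`: the contributions cancel unless exactly one of `z ± pos a` reaches `t`,
    -- and that one lies below `t + 2 * b`.
    have h2 : ∀ z, P.avg (fun a => pos a * step t (z + pos a))
        ≤ b * P.avg fun a => step t (z + pos a) - step (t + 2 * b) (z + pos a) := by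
      intro z
      have e1 := P.avg_inv fun a => pos a * step t (z + pos a)
      have e2 := P.avg_inv fun a => step t (z + pos a) - step (t + 2 * b) (z + pos a)
      have e3 := P.avg_mono
        (u := fun a => pos a * step t (z + pos a) + pos a⁻¹ * step t (z + pos a⁻¹))
        (v := fun a => b * (step t (z + pos a) - step (t + 2 * b) (z + pos a)) +
          b * (step t (z + pos a⁻¹) - step (t + 2 * b) (z + pos a⁻¹))) (fun a ha => by
            have hab := abs_le.1 (hb a ha)
            simp only [pos_inv, step]
            split_ifs <;> linarith)
      rw [avg_add, avg_add, avg_const_mul, avg_const_mul, e1, e2] at e3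
      linarith
    have h3 := P.walkAvg_mono n h2 0
    rw [walkAvg_const_mul, ← P.walkAvg_succ' n fun z => step t z - step (t + 2 * b) z,
      walkAvg_sub] at h3
    push_cast
    rw [mul_assoc]
    gcongr
    exact h3

/-- The tail of the walk decreases exponentially beyond `T`, at a rate proportional to `T`. -/
theorem tail_add_le {b : ℝ} (hb : ∀ a ∈ P.supp, |pos a| ≤ b) (hb0 : 0 < b) {n : ℕ} (hn : 0 < n)
    (T : ℝ) (k : ℕ) :
    P.tail n (T + 2 * b * k) ≤ Real.exp (-(T / (n * b) * k)) * P.tail n T := by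
  have hn' : (0 : ℝ) < n := by exact_mod_cast hn
  induction k with
  | zero => simp
  | succ k ih =>
    have h1 := P.mul_tail_le hb n (T + 2 * b * k)
    have h0 := P.tail_nonneg n (T + 2 * b * k)
    set q := P.tail n (T + 2 * b * k) with hq
    have h2 : T * q ≤ n * b * (q - P.tail n (T + 2 * b * k + 2 * b)) := by
      refine le_trans ?_ h1
      gcongr
      have : 0 ≤ 2 * b * k := by positivity
      linarith
    have h3 : P.tail n (T + 2 * b * k + 2 * b) ≤ (1 - T / (n * b)) * q := by
      have : T * q = n * b * (T / (n * b) * q) := by field_simp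
      rw [this] at h2
      have := le_of_mul_le_mul_left h2 (by positivity)
      linarith
    have h4 : 1 - T / (n * b) ≤ Real.exp (-(T / (n * b))) := by
      linarith [Real.add_one_le_exp (-(T / (n * b)))]
    have h5 : T + 2 * b * ((k + 1 : ℕ) : ℝ) = T + 2 * b * k + 2 * b := by push_cast; ring
    rw [h5]
    calc _ ≤ (1 - T / (n * b)) * q := h3
      _ ≤ Real.exp (-(T / (n * b))) * (Real.exp (-(T / (n * b) * k)) * P.tail n T) := by gcongr
      _ = _ := by
        rw [← mul_assoc, ← Real.exp_add]
        congr 2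
        push_cast
        ring

/-- Rising by `s` in the first `m` steps and by `t` in the next `n` are independent events. -/
theorem tail_mul_tail_le (m n : ℕ) (s t : ℝ) :
    P.tail m s * P.tail n t ≤ P.tail (m + n) (s + t) := by
  rw [tail, tail, tail, walkAvg_add_time, mul_comm, ← walkAvg_const_mul]
  refine P.walkAvg_mono m (fun y => ?_) 0
  by_cases hy : s ≤ y
  · rw [step, if_pos hy, mul_one]
    refine P.pathAvg_mono n fun l => ?_
    unfold step
    split_ifs <;> linarith
  · rw [step, if_neg hy, mul_zero]
    exact P.pathAvg_nonneg n fun _ => step_nonneg _ _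

theorem tail_pow_le (m r : ℕ) (s : ℝ) : P.tail m s ^ r ≤ P.tail (r * m) (r * s) := by
  induction r with
  | zero => simp [tail, walkAvg_zero, step]
  | succ r ih =>
    have h := P.tail_mul_tail_le (r * m) m (r * s) s
    have e1 : (r + 1) * m = r * m + m := by ring
    have e2 : ((r + 1 : ℕ) : ℝ) * s = r * s + s := by push_cast; ring
    rw [e1, e2, pow_succ]
    exact (mul_le_mul_of_nonneg_right ih (P.tail_nonneg _ _)).trans h

theorem walkAvg_step_neg (n : ℕ) (t : ℝ) : P.walkAvg n (fun z => step t (-z)) 0 = P.tail n t := by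
  rw [walkAvg_neg, neg_zero, tail]

theorem half_le_tail_zero (n : ℕ) : 1 / 2 ≤ P.tail n 0 := by
  have h := P.walkAvg_mono n (u := fun _ => 1) (v := fun z => step 0 z + step 0 (-z)) (fun z => by
    unfold step
    split_ifs <;> linarith) 0
  rw [walkAvg_const, walkAvg_add, walkAvg_step_neg] at h
  change 1 ≤ P.tail n 0 + P.tail n 0 at h
  linarith

/-- The variance of a step. -/
def var : ℝ := P.avg fun a => pos a ^ 2

theorem walkAvg_sq (n : ℕ) (x : ℝ) : P.walkAvg n (fun z => z ^ 2) x = x ^ 2 + n * P.var := by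
  induction n generalizing x with
  | zero => simp [walkAvg_zero]
  | succ n ih =>
    have h : ∀ a, (x + pos a) ^ 2 + n * P.var
        = (x ^ 2 + n * P.var) + (2 * x * pos a + pos a ^ 2) := fun a => by ring
    simp only [walkAvg_succ, ih, h, avg_add, avg_const, avg_const_mul, avg_pos]
    rw [var]
    push_cast
    ring

/-- Pairing `a` with `a⁻¹` removes the odd powers of the step. -/
theorem walkAvg_pow_four_le {b : ℝ} (hb : ∀ a ∈ P.supp, |pos a| ≤ b) (n : ℕ) :
    P.walkAvg n (fun z => z ^ 4) 0 ≤ 3 * b ^ 4 * n ^ 2 := by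
  induction n with
  | zero => simp [walkAvg_zero]
  | succ n ih =>
    have h1 : ∀ z, P.avg (fun a => (z + pos a) ^ 4) ≤ z ^ 4 + (6 * b ^ 2 * z ^ 2 + b ^ 4) := by
      intro z
      have e1 := P.avg_inv fun a => (z + pos a) ^ 4
      have e2 := P.avg_mono (u := fun a => (z + pos a) ^ 4 + (z + pos a⁻¹) ^ 4)
        (v := fun _ => 2 * (z ^ 4 + (6 * b ^ 2 * z ^ 2 + b ^ 4))) (fun a ha => by
          have h2 : pos a ^ 2 ≤ b ^ 2 :=
            sq_le_sq' (abs_le.1 (hb a ha)).1 (abs_le.1 (hb a ha)).2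
          have h3 : pos a ^ 2 * pos a ^ 2 ≤ b ^ 2 * b ^ 2 :=
            mul_le_mul h2 h2 (sq_nonneg _) (sq_nonneg _)
          have h4 := mul_le_mul_of_nonneg_right h2 (sq_nonneg z)
          rw [pos_inv]
          nlinarith)
      rw [avg_add, e1, avg_const] at e2
      linarith
    rw [walkAvg_succ']
    refine (P.walkAvg_mono n h1 0).trans ?_
    rw [walkAvg_add, walkAvg_add, walkAvg_const_mul, walkAvg_const, walkAvg_sq]
    have h2 : P.var ≤ b ^ 2 := P.avg_pos_sq_le hb
    have h3 : 6 * b ^ 2 * (0 ^ 2 + n * P.var) ≤ 6 * b ^ 4 * n := by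
      calc _ ≤ 6 * b ^ 2 * (0 ^ 2 + n * b ^ 2) := by gcongr
        _ = _ := by ring
    have h4 : 0 ≤ b ^ 4 := by positivity
    push_cast
    linarith

/-- A symmetric walk exceeds a multiple of its standard deviation with probability bounded below. -/
theorem le_tail_sqrt {b : ℝ} (hb : ∀ a ∈ P.supp, |pos a| ≤ b) (hb0 : 0 < b) (hv : 0 < P.var)
    {n : ℕ} (hn : 0 < n) :
    P.var ^ 2 / (24 * b ^ 4) ≤ P.tail n (√(P.var * n / 2)) := by
  have hn' : (0 : ℝ) < n := by exact_mod_cast hn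
  set v := P.var * n with hvdef
  have hv0 : 0 < v := by positivity
  set ν := v / (6 * b ^ 4 * n ^ 2) with hν
  have hν0 : 0 < ν := by positivity
  -- A Paley–Zygmund argument: the left side is at most `1` because `(ν z ^ 2 - 1) ^ 2 ≥ 0`, and
  -- nonpositive when `z ^ 2 ≤ v / 2`. The choice of `ν` makes the fourth-moment term at most half
  -- of `ν * v`.
  have h1 : ∀ z : ℝ, 2 * ν * z ^ 2 - ν * v - ν ^ 2 * z ^ 4
      ≤ step (√(v / 2)) z + step (√(v / 2)) (-z) := by
    intro z
    by_cases hz : √(v / 2) ≤ |z|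
    · have h2 : 1 ≤ step (√(v / 2)) z + step (√(v / 2)) (-z) := by
        rcases le_abs.1 hz with h | h
        · have : step (√(v / 2)) z = 1 := if_pos h
          linarith [step_nonneg (√(v / 2)) (-z)]
        · have : step (√(v / 2)) (-z) = 1 := if_pos h
          linarith [step_nonneg (√(v / 2)) z]
      nlinarith [sq_nonneg (ν * z ^ 2 - 1), mul_pos hν0 hv0]
    · have h2 : z ^ 2 ≤ v / 2 := by
        rw [← sq_abs, ← Real.sq_sqrt (by positivity : 0 ≤ v / 2)]
        have := (not_le.1 hz).le
        gcongr
      have h3 := mul_le_mul_of_nonneg_left h2 hν0.le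
      have h4 : 0 ≤ ν ^ 2 * z ^ 4 := by positivity
      linarith [step_nonneg (√(v / 2)) z, step_nonneg (√(v / 2)) (-z)]
  have h2 := P.walkAvg_mono n h1 0
  rw [walkAvg_sub, walkAvg_sub, walkAvg_const_mul, walkAvg_const_mul, walkAvg_const, walkAvg_sq,
    walkAvg_add, walkAvg_step_neg] at h2
  change _ ≤ P.tail n _ + P.tail n _ at h2
  have h3 := mul_le_mul_of_nonneg_left (P.walkAvg_pow_four_le hb n) (sq_nonneg ν)
  have h4 : ν ^ 2 * (3 * b ^ 4 * n ^ 2) = ν * v / 2 := by rw [hν]; field_simp; norm_num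
  have h5 : ν * v = 4 * (P.var ^ 2 / (24 * b ^ 4)) := by rw [hν, hvdef]; field_simp; norm_num
  have h6 : 2 * ν * (0 ^ 2 + n * P.var) = 2 * (ν * v) := by rw [hvdef]; ring
  rw [← walkAvg_const_mul] at h3
  linarith

/-- A lower bound for moderate deviations. -/
theorem pow_le_tail {b : ℝ} (hb : ∀ a ∈ P.supp, |pos a| ≤ b) (hb0 : 0 < b) (hv : 0 < P.var)
    {n r : ℕ} (hr : 0 < r) (hrn : r ≤ n) :
    (P.var ^ 2 / (24 * b ^ 4)) ^ r / 2 ≤ P.tail n (√(P.var * (r * n) / 4)) := by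
  -- Let each of `r` blocks of length `M` rise by its typical deviation `√(var M / 2)`; by symmetry
  -- the `n % r` leftover steps do not lower the endpoint with probability at least `1 / 2`.
  set M := n / r with hM
  have hM0 : 0 < M := Nat.div_pos hrn hr
  have hr' : (0 : ℝ) < r := by exact_mod_cast hr
  have h1 := P.tail_mul_tail_le (r * M) (n % r) (r * √(P.var * M / 2)) 0
  rw [Nat.div_add_mod, add_zero] at h1
  have h2 : √(P.var * (r * n) / 4) ≤ r * √(P.var * M / 2) := by
    have h3 : (n : ℝ) ≤ 2 * (r * M) := by
      have h4 := Nat.div_add_mod n r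
      rw [← hM] at h4
      have h5 := Nat.mod_lt n hr
      have h6 : r ≤ r * M := Nat.le_mul_of_pos_right r hM0
      have : n ≤ 2 * (r * M) := by omega
      exact_mod_cast this
    rw [Real.sqrt_le_left (by positivity), mul_pow, Real.sq_sqrt (by positivity)]
    have h4 := mul_le_mul_of_nonneg_left h3 (mul_pos hv hr').le
    linarith
  refine le_trans ?_ (h1.trans (P.tail_anti n h2))
  have h3 := (pow_le_pow_left₀ (by positivity) (P.le_tail_sqrt hb hb0 hv hM0) r).trans
    (P.tail_pow_le M r _)
  have h4 := P.half_le_tail_zero (n % r)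
  calc _ = (P.var ^ 2 / (24 * b ^ 4)) ^ r * (1 / 2) := by ring
    _ ≤ _ := mul_le_mul h3 h4 (by norm_num) (P.tail_nonneg _ _)

end Tail

end SymmSteps

/-! ### Choice of window, threshold and shift -/

namespace SymmSteps

variable (P : SymmSteps (Multiplicative ℤ))

set_option maxHeartbeats 1000000 in
/-- Parameters for which a window of `w` independent lamps contains lamps above the threshold `T`,
but the tails of the lamps decrease by a factor `4` from `T` to `T + L`. -/
theorem exists_window (hv : 0 < P.var) {c C : ℝ} (D : ℝ) (hc : 0 < c) (hC : 0 < C) :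
    ∃ K : ℝ, ∀ᶠ s : ℕ in atTop, ∃ (w L : ℕ) (T : ℝ), 0 < w ∧ D * ((w : ℝ) ^ 3 + 1) ≤ s ∧
      w ≤ K * logScale (1 / 2) s ∧ L ≤ K * logScale (1 / 2) s ∧
      ∀ n : ℕ, c * s ≤ n → n ≤ C * s →
        P.tail n (T + L) ≤ 1 / 4 * P.tail n T ∧ 3 ≤ w * P.tail n T := by
  obtain ⟨b, hb1, hb⟩ : ∃ b : ℕ, 1 ≤ b ∧ ∀ a ∈ P.supp, |pos a| ≤ b := by
    obtain ⟨b, hb⟩ := exists_nat_ge (∑ a ∈ P.supp, |pos a|)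
    refine ⟨b + 1, by omega, fun a ha => ?_⟩
    have := Finset.single_le_sum (f := fun a => |pos a|) (fun a _ => abs_nonneg (pos a)) ha
    push_cast
    linarith
  have hb1' : (1 : ℝ) ≤ b := by exact_mod_cast hb1
  have hb0 : (0 : ℝ) < b := by linarith
  set p₀ := P.var ^ 2 / (24 * (b : ℝ) ^ 4) with hp₀
  have hp0 : 0 < p₀ := by positivity
  have hp1 : p₀ < 1 := by
    have h1 : P.var ≤ (b : ℝ) ^ 2 := P.avg_pos_sq_le hb
    have h2 : P.var ^ 2 ≤ ((b : ℝ) ^ 2) ^ 2 := by gcongr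
    rw [hp₀, div_lt_one (by positivity)]
    have : 0 < (b : ℝ) ^ 4 := by positivity
    linarith
  set Λ := -Real.log p₀ with hΛ
  have hΛ0 : 0 < Λ := neg_pos.2 (Real.log_neg hp0 hp1)
  -- With `r ≤ η log s` blocks the moderate deviation bound costs at most `p₀ ^ r ≥ s ^ (-1/8)`, to
  -- be beaten by a window of about `s ^ (1/4)` sites.
  set η := 1 / (8 * Λ) with hη
  have hη0 : 0 < η := by positivity
  set c₃ := √(P.var * η * c / 8) with hc₃
  have hc₃0 : 0 < c₃ := Real.sqrt_pos.2 (by positivity)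
  -- Chosen so that `T * k ≥ 2 * C * s * b`: the decay exponent `T / (n * b) * k` is then at least
  -- `2` for all `n ≤ C * s`, and `exp (-2) ≤ 1 / 4`.
  set K₀ := 2 * C * b / c₃ with hK₀
  have hK₀0 : 0 < K₀ := by positivity
  refine ⟨2 * b * (K₀ + 1), ?_⟩
  have hlog : Tendsto (fun s : ℕ => Real.log s) atTop atTop :=
    Real.tendsto_log_atTop.comp tendsto_natCast_atTop_atTop
  have hexp : ∀ d : ℝ, 0 < d → Tendsto (fun s : ℕ => Real.exp (Real.log s / d)) atTop atTop :=
    fun d hd => Real.tendsto_exp_atTop.comp (hlog.atTop_div_const hd)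
  have hlit : ∀ᶠ s : ℕ in atTop, η * Real.log s ≤ c * s := by
    have := (Real.isLittleO_log_id_atTop.bound (show 0 < c / η by positivity))
    filter_upwards [tendsto_natCast_atTop_atTop.eventually this, eventually_ge_atTop 1] with s hs hs1
    have h1 : (1 : ℝ) ≤ s := by exact_mod_cast hs1
    rw [Real.norm_of_nonneg (Real.log_nonneg h1), id, Real.norm_of_nonneg (by linarith)] at hs
    calc η * Real.log s ≤ η * (c / η * s) := by gcongr
      _ = c * s := by field_simp
  filter_upwards [hlog.eventually_ge_atTop 1, hlog.eventually_ge_atTop (2 / η), hlit,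
    (hexp 4 (by norm_num)).eventually_ge_atTop (2 * D),
    (hexp 4 (by norm_num)).eventually_ge_atTop 2, (hexp 8 (by norm_num)).eventually_ge_atTop 12,
    (tendsto_logScale (show (0 : ℝ) < 1 / 2 by norm_num)).eventually_ge_atTop 1,
    eventually_ge_atTop 1] with s hl1 hlη hlin hD h2 h12 hS hs1
  set ℓ := Real.log s with hℓ
  have hs0 : (0 : ℝ) < s := by exact_mod_cast hs1
  have hsexp : (s : ℝ) = Real.exp ℓ := (Real.exp_log hs0).symm
  set e := Real.exp (ℓ / 4) with he
  have he4 : (s : ℝ) = e ^ 4 := by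
    rw [he, ← Real.exp_nat_mul, hsexp]; congr 1; push_cast; ring
  have hsqrt : √(s : ℝ) = e ^ 2 := by
    rw [he4, show e ^ 4 = (e ^ 2) ^ 2 by ring, Real.sqrt_sq (by positivity)]
  have hSeq : logScale (1 / 2) s = √s / √ℓ := by rw [logScale, Real.sqrt_eq_rpow (s : ℝ)]
  set S := logScale (1 / 2) s with hSdef
  -- Here `e = s ^ (1/4)`, so that `w ^ 3 ≤ s ^ (3/4)` is negligible against `s`, as the occupation
  -- estimate requires.
  set w := ⌊e⌋₊ with hw
  set r := ⌊η * ℓ⌋₊ with hr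
  set k := ⌈K₀ * S⌉₊ with hk
  have hwe : (w : ℝ) ≤ e := Nat.floor_le (by positivity)
  have hew : e / 2 ≤ w := by linarith [Nat.lt_floor_add_one e]
  have hηℓ : 2 ≤ η * ℓ := by rwa [div_le_iff₀ hη0, mul_comm] at hlη
  have hr1 : (r : ℝ) ≤ η * ℓ := Nat.floor_le (by linarith)
  have hr2 : η * ℓ / 2 ≤ r := by linarith [Nat.lt_floor_add_one (η * ℓ)]
  have hr0 : 0 < r := by
    have : (0 : ℝ) < r := by linarith
    exact_mod_cast this
  have hk1 : K₀ * S ≤ k := Nat.le_ceil _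
  have hk2 : (k : ℝ) ≤ K₀ * S + 1 := (Nat.ceil_lt_add_one (by positivity)).le
  have hℓ0 : 0 < √ℓ := Real.sqrt_pos.2 (by linarith)
  -- The threshold uses the smallest admissible time `c * s`, so the lower bound for the tail holds
  -- for all larger `n` too.
  set T := √(P.var * (r * (c * s)) / 4) with hT
  have hTlow : c₃ * (√ℓ * √s) ≤ T := by
    rw [hc₃, ← Real.sqrt_mul (by linarith), ← Real.sqrt_mul (by positivity), hT]
    refine Real.sqrt_le_sqrt ?_
    calc P.var * η * c / 8 * (ℓ * s) = P.var * ((η * ℓ / 2) * (c * s)) / 4 := by ring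
      _ ≤ P.var * (r * (c * s)) / 4 := by gcongr
  refine ⟨w, 2 * b * k, T, Nat.floor_pos.2 (by linarith), ?_, ?_, ?_, fun n hn1 hn2 => ⟨?_, ?_⟩⟩
  · have h3 : (w : ℝ) ^ 3 ≤ e ^ 3 := by gcongr
    have h4 : 1 ≤ e ^ 3 := one_le_pow₀ (by linarith)
    calc D * ((w : ℝ) ^ 3 + 1) ≤ (e / 2) * ((w : ℝ) ^ 3 + 1) := by gcongr; linarith
      _ ≤ (e / 2) * (2 * e ^ 3) := by gcongr; linarith
      _ = s := by rw [he4]; ring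
  · have h3 : √ℓ ≤ e := by
      have h4 : √ℓ ≤ ℓ / 4 + 1 := by
        nlinarith [sq_nonneg (√ℓ / 2 - 1), Real.sq_sqrt (show 0 ≤ ℓ by linarith)]
      exact h4.trans (Real.add_one_le_exp _)
    have h5 : (w : ℝ) ≤ S := by
      rw [hSeq, hsqrt, le_div_iff₀ hℓ0, sq]
      exact mul_le_mul hwe h3 hℓ0.le (by positivity)
    have h6 : 1 ≤ 2 * (b : ℝ) * (K₀ + 1) := by nlinarith
    exact h5.trans (le_mul_of_one_le_left (by linarith) h6)
  · push_cast
    calc 2 * (b : ℝ) * k ≤ 2 * b * (K₀ * S + S) := by gcongr; linarith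
      _ = _ := by ring
  · have hn0 : (0 : ℝ) < n := lt_of_lt_of_le (by positivity) hn1
    have h3 := P.tail_add_le hb hb0 (by exact_mod_cast hn0 : 0 < n) T k
    push_cast
    refine h3.trans ?_
    gcongr
    · exact P.tail_nonneg _ _
    have h4 : 2 ≤ T / (n * b) * k := by
      rw [div_mul_eq_mul_div, le_div_iff₀ (by positivity)]
      calc 2 * ((n : ℝ) * b) ≤ 2 * (C * s * b) := by gcongr
        _ = (c₃ * (√ℓ * √s)) * (K₀ * (√s / √ℓ)) := by
          rw [hK₀]
          have : √(s : ℝ) * √s = s := Real.mul_self_sqrt hs0.le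
          field_simp
          rw [sq, this]
        _ ≤ T * k := by
          rw [← hSeq]
          exact mul_le_mul hTlow hk1 (by positivity) (by positivity)
    calc Real.exp (-(T / (n * b) * k)) ≤ Real.exp (-2) := by gcongr
      _ ≤ 1 / 4 := by
        rw [Real.exp_neg, one_div]
        refine inv_anti₀ (by norm_num) ?_
        have h5 : Real.exp 2 = Real.exp 1 ^ 2 := by rw [← Real.exp_nat_mul]; norm_num
        rw [h5]
        have h6 : (2 : ℝ) ≤ Real.exp 1 := by linarith [Real.add_one_le_exp 1]
        calc (4 : ℝ) = 2 ^ 2 := by norm_num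
          _ ≤ Real.exp 1 ^ 2 := by gcongr
  · have hrn : r ≤ n := by
      have : (r : ℝ) ≤ n := hr1.trans (hlin.trans hn1)
      exact_mod_cast this
    have h3 := P.pow_le_tail hb hb0 hv hr0 hrn
    have h4 : P.tail n (√(P.var * (r * n) / 4)) ≤ P.tail n T :=
      P.tail_anti n (Real.sqrt_le_sqrt (by gcongr))
    have h5 : Real.exp (-(ℓ / 8)) ≤ p₀ ^ r := by
      rw [← Real.exp_log hp0, ← Real.exp_nat_mul]
      refine Real.exp_le_exp.2 ?_
      have h6 : (r : ℝ) * Λ ≤ η * ℓ * Λ := by gcongr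
      have h7 : η * ℓ * Λ = ℓ / 8 := by rw [hη]; field_simp
      rw [h7, hΛ] at h6
      linarith
    have h8 : Real.exp (-(ℓ / 8)) / 2 ≤ P.tail n T := by linarith
    have h9 : e = Real.exp (ℓ / 8) * Real.exp (ℓ / 8) := by
      rw [he, ← Real.exp_add]; congr 1; ring
    calc (3 : ℝ) ≤ Real.exp (ℓ / 8) / 4 := by linarith
      _ = (e / 2) * (Real.exp (-(ℓ / 8)) / 2) := by
        rw [h9, Real.exp_neg]; field_simp; norm_num
      _ ≤ w * P.tail n T := by gcongr

end SymmSteps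

/-! ### Passing from the scale at `√N` to the scale at `N` -/

/-- The scale `N ^ (α / 2) / √(log N)` dominates the scale of exponent `α` at `√N`. -/
theorem logScale_sqrt_le {α : ℝ} (hα : 0 ≤ α) {N : ℕ} (hN : 16 ≤ N) :
    logScale α N.sqrt ≤ 2 * logScale (α / 2) N := by
  have hN' : (16 : ℝ) ≤ N := by exact_mod_cast hN
  have hN0 : (0 : ℝ) < N := by linarith
  have h1 : (N.sqrt : ℝ) ≤ (N : ℝ) ^ (1 / 2 : ℝ) := by
    rw [← Real.sqrt_eq_rpow]; exact Real.nat_sqrt_le_real_sqrt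
  -- A crude bound for the rounded root, sufficient because the logarithm then loses only a factor
  -- `4`, and its square root a factor `2`.
  have h2 : (N : ℝ) ^ (1 / 4 : ℝ) ≤ N.sqrt := by
    set q := (N : ℝ) ^ (1 / 4 : ℝ) with hq
    have hq0 : 0 ≤ q := by positivity
    have h3 : √(N : ℝ) = q ^ 2 := by
      rw [Real.sqrt_eq_rpow, hq, ← Real.rpow_natCast, ← Real.rpow_mul hN0.le]; norm_num
    have h4 : (4 : ℝ) ≤ √N := Real.le_sqrt_of_sq_le (by linarith)
    have h5 : √(N : ℝ) ≤ N.sqrt + 1 := Real.real_sqrt_le_nat_sqrt_succ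
    have h6 : 2 ≤ q := by nlinarith
    nlinarith
  have hlog : 0 < Real.log N := Real.log_pos (by linarith)
  have h3 : Real.log N / 4 ≤ Real.log N.sqrt := by
    calc Real.log N / 4 = Real.log ((N : ℝ) ^ (1 / 4 : ℝ)) := by rw [Real.log_rpow hN0]; ring
      _ ≤ _ := Real.log_le_log (by positivity) h2
  have h4 : √(Real.log N) / 2 ≤ √(Real.log N.sqrt) := by
    refine Real.le_sqrt_of_sq_le ?_
    rw [div_pow, Real.sq_sqrt hlog.le]
    linarith
  have h5 : ((N.sqrt : ℝ)) ^ α ≤ (N : ℝ) ^ (α / 2) := by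
    calc ((N.sqrt : ℝ)) ^ α ≤ ((N : ℝ) ^ (1 / 2 : ℝ)) ^ α := by gcongr
      _ = _ := by rw [← Real.rpow_mul hN0.le]; congr 1; ring
  have h6 : 0 < √(Real.log N) := Real.sqrt_pos.2 hlog
  calc logScale α N.sqrt ≤ (N : ℝ) ^ (α / 2) / (√(Real.log N) / 2) := by
        unfold logScale; gcongr
    _ = _ := by unfold logScale; field_simp

section Mixture

theorem expect_le_of_prob_ge {β : Type*} (p : PMF β) {f : β → ℝ≥0∞} {S : Set β} {q δ : ℝ}
    (hq : 0 ≤ q) (hδ0 : 0 ≤ δ) (hδ1 : δ ≤ 1) (hS : ENNReal.ofReal q ≤ prob p S)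
    (hf : ∀ a, f a ≤ 1) (hfS : ∀ a ∈ S, f a ≤ ENNReal.ofReal (1 - δ)) :
    expect p f ≤ ENNReal.ofReal (1 - q * δ) := by
  have h1 : expect p f + ENNReal.ofReal δ * prob p S ≤ 1 := by
    rw [prob, ← expect_mul_left, ← expect_add, ← expect_const p 1]
    refine expect_mono p fun a => ?_
    by_cases ha : a ∈ S
    · rw [Set.indicator_of_mem ha, Pi.one_apply, mul_one]
      refine (add_le_add_left (hfS a ha) _).trans ?_
      rw [← ENNReal.ofReal_add (by linarith) hδ0]
      simp
    · simpa [Set.indicator_of_notMem ha] using hf a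
  rw [ENNReal.ofReal_sub _ (by positivity), ENNReal.ofReal_one]
  refine ENNReal.le_sub_of_add_le_right ENNReal.ofReal_ne_top (le_trans ?_ h1)
  rw [mul_comm, ENNReal.ofReal_mul hδ0]
  gcongr

end Mixture

/-! ### The induction step: one more wreath product halves the exponent -/

section WreathStep

variable {B : Type} [Group B]

theorem prob_pathLaw_visitCount_ge {μA : PMF (Multiplicative ℤ)} (hfin : μA.support.Finite)
    (hμA : IsSymmPMF μA) {a : Multiplicative ℤ} (ha1 : a ≠ 1) (ha : μA a ≠ 0) :
    ∃ c C D : ℝ, 0 < c ∧ 0 < C ∧ ∀ n w : ℕ, D * ((w : ℝ) ^ 3 + 1) ≤ √n →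
      ENNReal.ofReal (1 / 32) ≤ prob (pathLaw μA n) {l | ∀ k < w, c * √n ≤ visitCount 1 l (a ^ k) ∧
        (visitCount 1 l (a ^ k) : ℝ) ≤ C * √n} := by
  obtain ⟨c, C, D, hc, hC, h⟩ := (SymmSteps.ofPMF μA hfin hμA).exists_pathAvg_visitCount_ge
    (a := a) (hfin.mem_toFinset.2 ha) (ENNReal.toReal_pos ha (PMF.apply_ne_top _ _)) ha1
  refine ⟨c, C, D, hc, hC, fun n w hn => ?_⟩
  rw [SymmSteps.prob_pathLaw_eq hfin hμA]
  exact ENNReal.ofReal_le_ofReal (h n w hn)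

/-- Times comparable with `N` have square roots comparable with `Nat.sqrt N`. -/
theorem sqrt_mem_of_mem {c C : ℝ} {N m : ℕ} (hN : 1 ≤ N) (h1 : c * N ≤ m) (h2 : (m : ℝ) ≤ C * N) :
    √c * N.sqrt ≤ √(m : ℝ) ∧ √(m : ℝ) ≤ 2 * √C * N.sqrt := by
  have e1 : √c * √(N : ℝ) ≤ √(m : ℝ) := by
    rw [← Real.sqrt_mul' _ (by positivity)]; exact Real.sqrt_le_sqrt h1
  have e2 : √(m : ℝ) ≤ √C * √(N : ℝ) := by
    rw [← Real.sqrt_mul' _ (by positivity)]; exact Real.sqrt_le_sqrt h2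
  have e3 : (N.sqrt : ℝ) ≤ √(N : ℝ) := Real.nat_sqrt_le_real_sqrt
  have e4 : √(N : ℝ) ≤ 2 * N.sqrt := by
    have h3 : √(N : ℝ) ≤ N.sqrt + 1 := Real.real_sqrt_le_nat_sqrt_succ
    have h4 : (1 : ℝ) ≤ N.sqrt := by exact_mod_cast Nat.le_sqrt.2 (by omega : 1 * 1 ≤ N)
    linarith
  constructor
  · exact le_trans (by gcongr) e1
  · calc √(m : ℝ) ≤ √C * (2 * N.sqrt) := e2.trans (by gcongr)
      _ = _ := by ring

theorem tendsto_nat_sqrt : Tendsto Nat.sqrt atTop atTop :=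
  tendsto_atTop.2 fun b => by
    filter_upwards [eventually_ge_atTop (b * b)] with N hN
    exact Nat.le_sqrt.2 hN

theorem prob_convPow_swsMeasure_lamp (μA : PMF (Multiplicative ℤ)) (μB : PMF B) (m : ℕ) (E : Set B) :
    prob (convPow (swsMeasure μA μB) m) {h | h.1.left 1 ∈ E}
      = expect (pathLaw μA m) fun l => prob (convPow μB (visitCount 1 l 1)) E := by
  have h := expect_convPow_swsMeasure μA μB m 1 {1} fun _ => E.indicator 1
  simp only [Finset.prod_singleton, inv_one, one_mul] at h
  exact h

/-- Only the lamp at the identity is displaced, by the displacement of the lamp group at scale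
`N.sqrt`. Injectivity lifts because that lamp before the move determines the translation. The lost
mass shrinks by the factor `1 / 32`, the probability that the switch count is typical. -/
theorem DisplacesMass.swsMeasure {μA : PMF (Multiplicative ℤ)} (hfin : μA.support.Finite)
    (hμA : IsSymmPMF μA) {a : Multiplicative ℤ} (ha1 : a ≠ 1) (ha : μA a ≠ 0) {μB : PMF B} {α : ℝ}
    (hα : 0 ≤ α) (h : DisplacesMass μB α) : DisplacesMass (swsMeasure μA μB) (α / 2) := by
  obtain ⟨x, y, c₀, hc₀, hc₁, h⟩ := h
  obtain ⟨cp, Cp, D, hcp, hCp, hpath⟩ := prob_pathLaw_visitCount_ge hfin hμA ha1 ha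
  refine ⟨switchHom _ B x, switchHom _ B y, 1 / 32 * c₀, by positivity, by linarith,
    fun c C hc => ?_⟩
  have hsc : 0 < √c := Real.sqrt_pos.2 hc
  -- The range of switch counts at the identity, in units of `N.sqrt`, on typical paths of length
  -- between `c * N` and `C * N`.
  obtain ⟨K, hK⟩ := h (cp * √c) (Cp * (2 * √C)) (by positivity)
  refine ⟨2 * max K 0, ?_⟩
  filter_upwards [tendsto_nat_sqrt.eventually hK, eventually_ge_atTop 16,
    (tendsto_natCast_atTop_atTop.comp tendsto_nat_sqrt).eventually_ge_atTop (2 * D / √c)]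
    with N hN hN16 hND
  obtain ⟨g, E, F, hinj, hmaps, hg, hE, hF⟩ := hN
  have hleft : ∀ h : restrictedWreath (Multiplicative ℤ) B,
      (switchHom _ B (g (h.1.left 1)) * h).1.left 1 = g (h.1.left 1) * h.1.left 1 := by
    intro h
    change (switchElt (g (h.1.left 1)) * h).1.left 1 = _
    rw [wreath_mul_left, switchElt_left_one, switchElt_right, inv_one, one_mul]
  refine ⟨fun h => switchHom _ B (g (h.1.left 1)), {h | h.1.left 1 ∈ E}, {h | h.1.left 1 ∈ F},
    ?_, ?_, ?_, ?_, ?_⟩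
  · intro h hh h' hh' heq
    have h1 := congrArg (fun h => h.1.left 1) heq
    simp only [hleft] at h1
    have h2 : h.1.left 1 = h'.1.left 1 := hinj hh hh' h1
    simp only [h2] at heq
    exact mul_left_cancel heq
  · intro h hh
    change (switchHom _ B (g (h.1.left 1)) * h).1.left 1 ∈ F
    rw [hleft]
    exact hmaps hh
  · intro h
    obtain ⟨k, l, hk, hl, hgh⟩ := hg (h.1.left 1)
    have hR : K * logScale α N.sqrt ≤ 2 * max K 0 * logScale (α / 2) N := by
      calc K * logScale α N.sqrt ≤ max K 0 * (2 * logScale (α / 2) N) :=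
            mul_le_mul (le_max_left _ _) (logScale_sqrt_le hα hN16) (logScale_nonneg _ _)
              (le_max_right _ _)
        _ = _ := by ring
    exact ⟨k, l, hk.trans hR, hl.trans hR, by
      simp only [hgh, map_mul, map_pow, map_inv]⟩
  · intro m
    rw [prob_convPow_swsMeasure_lamp]
    simp only [hE, expect_const]
  · intro m hm1 hm2
    obtain ⟨h1, h2⟩ := sqrt_mem_of_mem (by omega) hm1 hm2
    rw [prob_convPow_swsMeasure_lamp]
    -- A window of the single site `1` is enough.
    refine expect_le_of_prob_ge _ (by norm_num) hc₀.le hc₁ (hpath m 1 ?_)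
      (fun l => prob_le_one _ _) fun l hl => ?_
    · rw [Function.comp_apply, div_le_iff₀ hsc] at hND
      push_cast
      linarith
    · obtain ⟨h3, h4⟩ := hl 0 one_pos
      rw [pow_zero] at h3 h4
      refine hF _ (le_trans ?_ h3) (h4.trans ?_)
      · rw [mul_assoc]; gcongr
      · rw [mul_assoc]; gcongr

end WreathStep

/-! ### The first success among independent trials -/

section FirstSite

theorem sum_prod_one_sub_mul (q : ℕ → ℝ) (w : ℕ) :
    ∑ k ∈ Finset.range w, (∏ i ∈ Finset.range k, (1 - q i)) * q k
      = 1 - ∏ k ∈ Finset.range w, (1 - q k) := by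
  induction w with
  | zero => simp
  | succ w ih => rw [Finset.sum_range_succ, ih, Finset.prod_range_succ]; ring

theorem prod_add_sum_le_one {q q' : ℕ → ℝ} (hq : ∀ k, q k ≤ 1) (hq' : ∀ k, q' k ≤ q k) (w : ℕ) :
    ∏ k ∈ Finset.range w, (1 - q k)
      + ∑ k ∈ Finset.range w, (∏ i ∈ Finset.range k, (1 - q i)) * q' k ≤ 1 := by
  have h1 : ∑ k ∈ Finset.range w, (∏ i ∈ Finset.range k, (1 - q i)) * q' k
      ≤ ∑ k ∈ Finset.range w, (∏ i ∈ Finset.range k, (1 - q i)) * q k :=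
    Finset.sum_le_sum fun k _ => mul_le_mul_of_nonneg_left (hq' k)
      (Finset.prod_nonneg fun i _ => sub_nonneg.2 (hq i))
  rw [sum_prod_one_sub_mul] at h1
  linarith

/-- No trial succeeds with probability at most `exp (-3) ≤ 1 / 8`, and the first success is of the
rarer kind with probability at most `1 / 4`. -/
theorem prod_add_sum_le_half {q q' : ℕ → ℝ} {w : ℕ} (hw0 : 0 < w) (hq : ∀ k, q k ≤ 1)
    (hq' : ∀ k < w, q' k ≤ 1 / 4 * q k) (hw : ∀ k < w, 3 ≤ w * q k) :
    ∏ k ∈ Finset.range w, (1 - q k)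
      + ∑ k ∈ Finset.range w, (∏ i ∈ Finset.range k, (1 - q i)) * q' k ≤ 1 / 2 := by
  have hw0' : (0 : ℝ) < w := by exact_mod_cast hw0
  have h1 : ∑ k ∈ Finset.range w, (∏ i ∈ Finset.range k, (1 - q i)) * q' k
      ≤ 1 / 4 * ∑ k ∈ Finset.range w, (∏ i ∈ Finset.range k, (1 - q i)) * q k := by
    rw [Finset.mul_sum]
    refine Finset.sum_le_sum fun k hk => ?_
    have := mul_le_mul_of_nonneg_left (hq' k (Finset.mem_range.1 hk))
      (Finset.prod_nonneg fun i (_ : i ∈ Finset.range k) => sub_nonneg.2 (hq i))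
    linarith
  rw [sum_prod_one_sub_mul] at h1
  have h2 : ∏ k ∈ Finset.range w, (1 - q k) ≤ 1 / 8 := by
    calc ∏ k ∈ Finset.range w, (1 - q k) ≤ ∏ k ∈ Finset.range w, Real.exp (-(3 / w)) := by
          refine Finset.prod_le_prod (fun k _ => sub_nonneg.2 (hq k)) fun k hk => ?_
          have h3 : 3 / (w : ℝ) ≤ q k := by
            rw [div_le_iff₀ hw0', mul_comm]; exact hw k (Finset.mem_range.1 hk)
          linarith [Real.add_one_le_exp (-(3 / (w : ℝ)))]
      _ = (Real.exp 1 ^ 3)⁻¹ := by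
          rw [Finset.prod_const, Finset.card_range, ← Real.exp_nat_mul, ← Real.exp_nat_mul,
            ← Real.exp_neg]
          congr 1
          push_cast
          field_simp
      _ ≤ 1 / 8 := by
          have h4 : (2 : ℝ) ≤ Real.exp 1 := by linarith [Real.add_one_le_exp 1]
          rw [one_div]
          refine inv_anti₀ (by norm_num) ?_
          calc (8 : ℝ) = 2 ^ 3 := by norm_num
            _ ≤ Real.exp 1 ^ 3 := by gcongr
  linarith

end FirstSite

/-! ### The base case `ℤ ≀ ℤ`: raising the first high lamp -/

section Base

open Multiplicative SymmSteps

variable {B : Type} [Group B]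

/-- The lamps at distinct sites are independent given the path of the walker. -/
theorem expect_convPow_swsMeasure_sites (μA : PMF (Multiplicative ℤ)) (μB : PMF B) (m : ℕ)
    {σ : ℕ → Multiplicative ℤ} (hσ : Function.Injective σ) (s : Finset ℕ) (F : ℕ → B → ℝ≥0∞) :
    expect (convPow (swsMeasure μA μB) m) (fun h => ∏ k ∈ s, F k (h.1.left (σ k)))
      = expect (pathLaw μA m)
          fun l => ∏ k ∈ s, expect (convPow μB (visitCount 1 l (σ k))) (F k) := by
  have h := expect_convPow_swsMeasure μA μB m 1 (s.map ⟨σ, hσ⟩) fun y => F (Function.invFun σ y)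
  simpa only [Finset.prod_map, Function.Embedding.coeFn_mk, inv_one, one_mul,
    Function.leftInverse_invFun hσ _] using h

theorem conj_switch_left (u : Multiplicative ℤ) (b : B)
    (h : restrictedWreath (Multiplicative ℤ) B) (z : Multiplicative ℤ) :
    (walkHom _ B u * switchHom _ B b * (walkHom _ B u)⁻¹ * h).1.left z
      = if u = z then b * h.1.left z else h.1.left z := by
  have e : u⁻¹ * z = 1 ↔ u = z := inv_mul_eq_one
  rw [← map_inv]
  change (walkElt u * switchElt b * walkElt u⁻¹ * h).1.left z = _
  simp only [wreath_mul_left, wreath_mul_right, walkElt_left, walkElt_right, switchElt_right,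
    Pi.one_apply, one_mul, mul_one, mul_inv_cancel, inv_one]
  split_ifs with huz
  · rw [e.2 huz, switchElt_left_one]
  · rw [switchElt_left_of_ne _ (mt e.1 huz), one_mul]

/-- The first `k < w` for which the lamp at `a ^ k` is at least `T`. -/
def IsFirstAbove (a : Multiplicative ℤ) (w : ℕ) (T : ℝ)
    (h : restrictedWreath (Multiplicative ℤ) (Multiplicative ℤ)) (k : ℕ) : Prop :=
  k < w ∧ T ≤ pos (h.1.left (a ^ k)) ∧ ∀ i < k, pos (h.1.left (a ^ i)) < T

theorem IsFirstAbove.unique {a : Multiplicative ℤ} {w : ℕ} {T : ℝ}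
    {h : restrictedWreath (Multiplicative ℤ) (Multiplicative ℤ)} {k k' : ℕ}
    (hk : IsFirstAbove a w T h k) (hk' : IsFirstAbove a w T h k') : k = k' := by
  rcases lt_trichotomy k k' with h1 | h1 | h1
  · exact absurd (hk'.2.2 k h1) (not_lt.2 hk.2.1)
  · exact h1
  · exact absurd (hk.2.2 k' h1) (not_lt.2 hk'.2.1)

theorem exists_isFirstAbove {a : Multiplicative ℤ} {w : ℕ} {T : ℝ}
    {h : restrictedWreath (Multiplicative ℤ) (Multiplicative ℤ)} {k : ℕ} (hk : k < w)
    (hT : T ≤ pos (h.1.left (a ^ k))) : ∃ k, IsFirstAbove a w T h k := by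
  classical
  have hex : ∃ k, T ≤ pos (h.1.left (a ^ k)) := ⟨k, hT⟩
  exact ⟨Nat.find hex, (Nat.find_min' hex hT).trans_lt hk, Nat.find_spec hex,
    fun i hi => not_le.1 (Nat.find_min hex hi)⟩

/-- The configurations without a lamp above `T`, or with the first such lamp above `T + L`. -/
def noneOrHigh (a : Multiplicative ℤ) (w L : ℕ) (T : ℝ) :
    Set (restrictedWreath (Multiplicative ℤ) (Multiplicative ℤ)) :=
  {h | (∀ k < w, pos (h.1.left (a ^ k)) < T) ∨
    ∃ k, IsFirstAbove a w T h k ∧ T + L ≤ pos (h.1.left (a ^ k))}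

open Classical in
/-- The translation that raises the first lamp above `T` by `L`. -/
noncomputable def raise (a : Multiplicative ℤ) (w L : ℕ) (T : ℝ)
    (h : restrictedWreath (Multiplicative ℤ) (Multiplicative ℤ)) :
    restrictedWreath (Multiplicative ℤ) (Multiplicative ℤ) :=
  if hk : ∃ k, IsFirstAbove a w T h k then
    walkHom _ _ (a ^ hk.choose) * switchHom _ _ (ofAdd (L : ℤ)) * (walkHom _ _ (a ^ hk.choose))⁻¹
  else 1

theorem raise_of_isFirstAbove {a : Multiplicative ℤ} {w L : ℕ} {T : ℝ}
    {h : restrictedWreath (Multiplicative ℤ) (Multiplicative ℤ)} {k : ℕ}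
    (hk : IsFirstAbove a w T h k) :
    raise a w L T h
      = walkHom _ _ (a ^ k) * switchHom _ _ (ofAdd (L : ℤ)) * (walkHom _ _ (a ^ k))⁻¹ := by
  have hex : ∃ k, IsFirstAbove a w T h k := ⟨k, hk⟩
  rw [raise, dif_pos hex, hex.choose_spec.unique hk]

theorem raise_of_not {a : Multiplicative ℤ} {w L : ℕ} {T : ℝ}
    {h : restrictedWreath (Multiplicative ℤ) (Multiplicative ℤ)}
    (hk : ¬ ∃ k, IsFirstAbove a w T h k) : raise a w L T h = 1 := dif_neg hk

/-- Raising the selected lamp keeps it above `T` and leaves the earlier lamps alone. The selected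
site can thus be read off from the image, which gives injectivity. -/
theorem isFirstAbove_raise {a : Multiplicative ℤ} (ha : Function.Injective fun k : ℕ => a ^ k)
    {w L : ℕ} {T : ℝ} {h : restrictedWreath (Multiplicative ℤ) (Multiplicative ℤ)} {k : ℕ}
    (hk : IsFirstAbove a w T h k) :
    IsFirstAbove a w T (raise a w L T h * h) k ∧
      T + L ≤ pos ((raise a w L T h * h).1.left (a ^ k)) := by
  have h1 : pos ((raise a w L T h * h).1.left (a ^ k)) = L + pos (h.1.left (a ^ k)) := by
    rw [raise_of_isFirstAbove hk, conj_switch_left, if_pos rfl, pos_mul]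
    simp [pos]
  have h2 : ∀ i < k, (raise a w L T h * h).1.left (a ^ i) = h.1.left (a ^ i) := by
    intro i hi
    rw [raise_of_isFirstAbove hk, conj_switch_left, if_neg fun hki => hi.ne' (ha hki)]
  have hL : (0 : ℝ) ≤ L := Nat.cast_nonneg L
  have h3 := hk.2.1
  refine ⟨⟨hk.1, ?_, fun i hi => ?_⟩, ?_⟩
  · rw [h1]; linarith
  · rw [h2 i hi]; exact hk.2.2 i hi
  · rw [h1]; linarith

theorem raise_mul_injective {a : Multiplicative ℤ} (ha : Function.Injective fun k : ℕ => a ^ k)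
    (w L : ℕ) (T : ℝ) : Function.Injective fun h => raise a w L T h * h := by
  intro h h' heq
  simp only at heq
  by_cases hk : ∃ k, IsFirstAbove a w T h k <;> by_cases hk' : ∃ k, IsFirstAbove a w T h' k
  · obtain ⟨k, hk⟩ := hk
    obtain ⟨k', hk'⟩ := hk'
    have h1 := (isFirstAbove_raise ha (L := L) hk).1
    rw [heq] at h1
    obtain rfl := h1.unique (isFirstAbove_raise ha hk').1
    rw [raise_of_isFirstAbove hk, raise_of_isFirstAbove hk'] at heq
    exact mul_left_cancel heq
  · obtain ⟨k, hk⟩ := hk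
    have h1 := (isFirstAbove_raise ha (L := L) hk).1
    rw [heq, raise_of_not hk', one_mul] at h1
    exact absurd ⟨k, h1⟩ hk'
  · obtain ⟨k', hk'⟩ := hk'
    have h1 := (isFirstAbove_raise ha (L := L) hk').1
    rw [← heq, raise_of_not hk, one_mul] at h1
    exact absurd ⟨k', h1⟩ hk
  · rwa [raise_of_not hk, raise_of_not hk', one_mul, one_mul] at heq

theorem raise_mul_mem {a : Multiplicative ℤ} (ha : Function.Injective fun k : ℕ => a ^ k)
    (w L : ℕ) (T : ℝ) (h : restrictedWreath (Multiplicative ℤ) (Multiplicative ℤ)) :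
    raise a w L T h * h ∈ noneOrHigh a w L T := by
  by_cases hk : ∃ k, IsFirstAbove a w T h k
  · obtain ⟨k, hk⟩ := hk
    exact Or.inr ⟨k, isFirstAbove_raise ha hk⟩
  · rw [raise_of_not hk, one_mul]
    refine Or.inl fun k hkw => ?_
    by_contra hcon
    exact hk (exists_isFirstAbove hkw (not_lt.1 hcon))

theorem prob_convPow_tail {μ : PMF (Multiplicative ℤ)} (hfin : μ.support.Finite)
    (hμ : IsSymmPMF μ) (n : ℕ) (t : ℝ) :
    prob (convPow μ n) {z | t ≤ pos z} = ENNReal.ofReal ((ofPMF μ hfin hμ).tail n t) := by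
  rw [prob_convPow_eq hfin hμ, tail, walkAvg]
  congr 2
  funext l
  by_cases h : t ≤ pos l.prod <;> simp [step, h]

theorem prob_convPow_lt {μ : PMF (Multiplicative ℤ)} (hfin : μ.support.Finite)
    (hμ : IsSymmPMF μ) (n : ℕ) (t : ℝ) :
    prob (convPow μ n) {z | pos z < t} = ENNReal.ofReal (1 - (ofPMF μ hfin hμ).tail n t) := by
  have h := prob_add_prob_compl (convPow μ n) {z | t ≤ pos z}
  have hc : {z : Multiplicative ℤ | t ≤ pos z}ᶜ = {z | pos z < t} := by ext z; simp
  rw [hc, prob_convPow_tail hfin hμ] at h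
  rw [ENNReal.ofReal_sub _ (tail_nonneg _ _ _), ENNReal.ofReal_one, ← h,
    ENNReal.add_sub_cancel_left ENNReal.ofReal_ne_top]

/-- A union bound over the position of the first lamp above `T`; for each position, conditional
independence of the lamps gives a product. -/
theorem prob_noneOrHigh_le (μA : PMF (Multiplicative ℤ)) {μB : PMF (Multiplicative ℤ)}
    (hfin : μB.support.Finite) (hμ : IsSymmPMF μB) (m : ℕ) {a : Multiplicative ℤ}
    (ha : Function.Injective fun k : ℕ => a ^ k) (w L : ℕ) (T : ℝ) :
    prob (convPow (swsMeasure μA μB) m) (noneOrHigh a w L T)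
      ≤ expect (pathLaw μA m) fun l => ENNReal.ofReal (
          ∏ k ∈ Finset.range w, (1 - (ofPMF μB hfin hμ).tail (visitCount 1 l (a ^ k)) T)
          + ∑ k ∈ Finset.range w,
            (∏ i ∈ Finset.range k, (1 - (ofPMF μB hfin hμ).tail (visitCount 1 l (a ^ i)) T))
              * (ofPMF μB hfin hμ).tail (visitCount 1 l (a ^ k)) (T + L)) := by
  set P := ofPMF μB hfin hμ with hP
  set lo : Set (Multiplicative ℤ) := {z | pos z < T} with hlo
  set hi : Set (Multiplicative ℤ) := {z | T + L ≤ pos z} with hhi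
  have hpt : ∀ h, (noneOrHigh a w L T).indicator (1 : restrictedWreath (Multiplicative ℤ) (Multiplicative ℤ) → ℝ≥0∞) h
      ≤ ∏ k ∈ Finset.range w, lo.indicator 1 (h.1.left (a ^ k))
        + ∑ k ∈ Finset.range w, ∏ i ∈ Finset.range (k + 1),
          (if i = k then hi else lo).indicator 1 (h.1.left (a ^ i)) := by
    intro h
    by_cases hh : h ∈ noneOrHigh a w L T
    · rw [Set.indicator_of_mem hh, Pi.one_apply]
      rcases hh with hh | ⟨k, hk, hkL⟩
      · refine le_add_right (le_of_eq (Finset.prod_eq_one fun k hk => ?_).symm)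
        have hlk : h.1.left (a ^ k) ∈ lo := hh k (Finset.mem_range.1 hk)
        rw [Set.indicator_of_mem hlk, Pi.one_apply]
      · refine le_add_left (le_trans (le_of_eq ?_) (Finset.single_le_sum
          (fun _ _ => zero_le) (Finset.mem_range.2 hk.1)))
        refine (Finset.prod_eq_one fun i hi' => ?_).symm
        rw [Set.indicator_of_mem, Pi.one_apply]
        split_ifs with hik
        · rw [hik]; exact hkL
        · exact hk.2.2 i (lt_of_le_of_ne (Nat.lt_succ_iff.1 (Finset.mem_range.1 hi')) hik)
    · rw [Set.indicator_of_notMem hh]; exact zero_le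
  refine (expect_mono _ hpt).trans_eq ?_
  rw [expect_add, expect_finset_sum,
    expect_convPow_swsMeasure_sites μA μB m ha (Finset.range w) fun _ => lo.indicator 1]
  have h1 : ∀ k, expect (convPow (swsMeasure μA μB) m) (fun h => ∏ i ∈ Finset.range (k + 1),
      (if i = k then hi else lo).indicator (1 : Multiplicative ℤ → ℝ≥0∞) (h.1.left (a ^ i))) = _ := fun k =>
    expect_convPow_swsMeasure_sites μA μB m ha (Finset.range (k + 1))
      fun i => (if i = k then hi else lo).indicator 1
  simp only [h1]
  rw [← expect_finset_sum, ← expect_add]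
  refine expect_congr _ fun l _ => ?_
  have hq : ∀ n t, 0 ≤ 1 - P.tail n t := fun n t => sub_nonneg.2 (P.tail_le_one n t)
  have hprod : ∀ k, 0 ≤ ∏ i ∈ Finset.range k, (1 - P.tail (visitCount 1 l (a ^ i)) T) :=
    fun k => Finset.prod_nonneg fun i _ => hq _ _
  have h2 : ∀ k, ∏ i ∈ Finset.range k, expect (convPow μB (visitCount 1 l (a ^ i))) (lo.indicator 1)
      = ENNReal.ofReal (∏ i ∈ Finset.range k, (1 - P.tail (visitCount 1 l (a ^ i)) T)) := by
    intro k
    rw [ENNReal.ofReal_prod_of_nonneg fun i _ => hq _ _]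
    exact Finset.prod_congr rfl fun i _ => prob_convPow_lt hfin hμ _ _
  rw [ENNReal.ofReal_add (hprod w)
    (Finset.sum_nonneg fun k _ => mul_nonneg (hprod k) (P.tail_nonneg _ _)),
    ENNReal.ofReal_sum_of_nonneg fun k _ => mul_nonneg (hprod k) (P.tail_nonneg _ _), h2]
  congr 1
  refine Finset.sum_congr rfl fun k _ => ?_
  rw [ENNReal.ofReal_mul (hprod k), ← h2, Finset.prod_range_succ, if_pos rfl]
  congr 1
  · refine Finset.prod_congr rfl fun i hi' => ?_
    rw [if_neg (Finset.mem_range.1 hi').ne]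
  · exact prob_convPow_tail hfin hμ _ _

theorem var_pos_of_mem {μ : PMF (Multiplicative ℤ)} (hfin : μ.support.Finite) (hμ : IsSymmPMF μ)
    {b : Multiplicative ℤ} (hb1 : b ≠ 1) (hb : μ b ≠ 0) : 0 < (ofPMF μ hfin hμ).var := by
  have hpos : 0 < pos b ^ 2 := by
    have : toAdd b ≠ 0 := fun h => hb1 (toAdd_eq_zero.1 h)
    have : pos b ≠ 0 := by unfold pos; exact_mod_cast this
    positivity
  have hwt : 0 < (ofPMF μ hfin hμ).wt b := ENNReal.toReal_pos hb (PMF.apply_ne_top _ _)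
  exact (mul_pos hwt hpos).trans_le (Finset.single_le_sum
    (f := fun a => (ofPMF μ hfin hμ).wt a * pos a ^ 2)
    (fun a _ => mul_nonneg (SymmSteps.nonneg _ a) (sq_nonneg _)) (hfin.mem_toFinset.2 hb))

/-- The displacement is `raise` on a window along powers of `a`, with `a` a possible step of the
walker so that the occupation estimates apply. On typical paths all lamps of the window fall under
`exists_window` at `s = N.sqrt`; on the others the trivial bound `1` is used. -/
theorem displacesMass_swsMeasure_int {μA μB : PMF (Multiplicative ℤ)} (hfinA : μA.support.Finite)
    (hμA : IsSymmPMF μA) {a : Multiplicative ℤ} (ha1 : a ≠ 1) (ha : μA a ≠ 0)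
    (hfinB : μB.support.Finite) (hμB : IsSymmPMF μB) {b : Multiplicative ℤ} (hb1 : b ≠ 1)
    (hb : μB b ≠ 0) : DisplacesMass (swsMeasure μA μB) (1 / 4) := by
  have hinj : Function.Injective fun k : ℕ => a ^ k := by
    intro k k' hkk
    have h1 := congrArg toAdd hkk
    simp only [toAdd_pow, nsmul_eq_mul] at h1
    have h2 : toAdd a ≠ 0 := fun h => ha1 (toAdd_eq_zero.1 h)
    exact_mod_cast mul_right_cancel₀ h2 h1
  obtain ⟨cp, Cp, D, hcp, hCp, hpath⟩ := prob_pathLaw_visitCount_ge hfinA hμA ha1 ha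
  refine ⟨walkHom _ _ a, switchHom _ _ (ofAdd 1), 1 / 32 * (1 / 2), by norm_num, by norm_num,
    fun c C hc => ?_⟩
  have hsc : 0 < √c := Real.sqrt_pos.2 hc
  -- The `+ 1` makes the upper constant positive, since nothing is assumed about the sign of `C`.
  obtain ⟨K, hK⟩ := (ofPMF μB hfinB hμB).exists_window (var_pos_of_mem hfinB hμB hb1 hb)
    (c := cp * √c) (C := Cp * (2 * √C) + 1) (D / √c) (by positivity) (by positivity)
  refine ⟨2 * max K 0, ?_⟩
  filter_upwards [tendsto_nat_sqrt.eventually hK, eventually_ge_atTop 16] with N hN hN16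
  obtain ⟨w, L, T, hw0, hD, hw, hL, hT⟩ := hN
  have hR : K * logScale (1 / 2) N.sqrt ≤ 2 * max K 0 * logScale (1 / 4) N := by
    have h1 := logScale_sqrt_le (show (0 : ℝ) ≤ 1 / 2 by norm_num) hN16
    rw [show (1 / 2 : ℝ) / 2 = 1 / 4 by norm_num] at h1
    calc K * logScale (1 / 2) N.sqrt ≤ max K 0 * (2 * logScale (1 / 4) N) :=
          mul_le_mul (le_max_left _ _) h1 (logScale_nonneg _ _) (le_max_right _ _)
      _ = _ := by ring
  have hR0 : 0 ≤ 2 * max K 0 * logScale (1 / 4) N :=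
    mul_nonneg (by positivity) (logScale_nonneg _ _)
  refine ⟨raise a w L T, Set.univ, noneOrHigh a w L T, (raise_mul_injective hinj w L T).injOn,
    fun h _ => raise_mul_mem hinj w L T h, fun h => ?_,
    fun m => prob_eq_one _ (Set.subset_univ _), fun m hm1 hm2 => ?_⟩
  · by_cases hk : ∃ k, IsFirstAbove a w T h k
    · obtain ⟨k, hk⟩ := hk
      refine ⟨k, L, ?_, hL.trans hR, ?_⟩
      · have : (k : ℝ) ≤ w := by exact_mod_cast hk.1.le
        exact this.trans (hw.trans hR)
      · rw [raise_of_isFirstAbove hk, map_pow, ← map_pow (switchHom _ _) (ofAdd 1), ← ofAdd_nsmul]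
        simp
    · exact ⟨0, 0, by simpa using hR0, by simpa using hR0, by simp [raise_of_not hk]⟩
  · obtain ⟨h1, h2⟩ := sqrt_mem_of_mem (by omega) hm1 hm2
    refine (prob_noneOrHigh_le μA hfinB hμB m hinj w L T).trans ?_
    have hL0 : (0 : ℝ) ≤ L := Nat.cast_nonneg L
    refine expect_le_of_prob_ge _ (by norm_num) (by norm_num) (by norm_num) (hpath m w ?_)
      (fun l => ?_) fun l hl => ?_
    · rw [div_mul_eq_mul_div, div_le_iff₀ hsc] at hD
      linarith
    · rw [ENNReal.ofReal_le_one]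
      exact prod_add_sum_le_one (fun k => tail_le_one _ _ _)
        (fun k => tail_anti _ _ (by linarith)) w
    · have hν : ∀ k < w, _ := fun k hk => hT (visitCount 1 l (a ^ k))
        (le_trans (by rw [mul_assoc]; gcongr) (hl k hk).1)
        ((hl k hk).2.trans (by
          have : Cp * √(m : ℝ) ≤ Cp * (2 * √C * N.sqrt) := by gcongr
          have : (0 : ℝ) ≤ N.sqrt := Nat.cast_nonneg _
          linarith))
      refine ENNReal.ofReal_le_ofReal ?_
      rw [show (1 : ℝ) - 1 / 2 = 1 / 2 by norm_num]
      exact prod_add_sum_le_half hw0 (fun k => tail_le_one _ _ _) (fun k hk => (hν k hk).1)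
        fun k hk => (hν k hk).2

end Base

/-! ### Degenerate measures and induction over the wreath products -/

section Iterated

open Multiplicative

variable {A B : Type} [Group A] [Group B]

theorem exists_of_mem_support_swsMeasure {μA : PMF A} {μB : PMF B} {g : restrictedWreath A B}
    (hg : g ∈ (swsMeasure μA μB).support) : ∃ a ∈ μA.support, ∃ b ∈ μB.support, ∃ b' ∈ μB.support,
      switchElt b * walkElt a * switchElt b' = g := by
  simp only [swsMeasure, pmfConv, PMF.mem_support_bind_iff, PMF.mem_support_map_iff] at hg
  obtain ⟨_, ⟨_, ⟨b, hb, rfl⟩, _, ⟨a, ha, rfl⟩, rfl⟩, _, ⟨b', hb', rfl⟩, rfl⟩ := hg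
  exact ⟨a, ha, b, hb, b', hb', rfl⟩

/-- The walk stays in the kernel of the projection to the acting group. -/
theorem displacesMass_of_trivial_walk {μA : PMF (Multiplicative ℤ)} (μB : PMF B)
    (hA : ∀ a, a ≠ 1 → μA a = 0) {α : ℝ} (hα : 0 < α) : DisplacesMass (swsMeasure μA μB) α := by
  refine displacesMass_of_subgroup
    (H := (RegularWreathProduct.rightHom.comp
      (restrictedWreath (Multiplicative ℤ) B).subtype).ker)
    (fun g hg => ?_) (y := walkElt (ofAdd 1)) (fun hy => ?_) hα
  · obtain ⟨a, ha, b, -, b', -, rfl⟩ := exists_of_mem_support_swsMeasure hg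
    have ha1 : a = 1 := by_contra fun h => ha (hA a h)
    rw [ha1, MonoidHom.mem_ker]
    rfl
  · rw [MonoidHom.mem_ker] at hy
    have h1 : (ofAdd 1 : Multiplicative ℤ) = 1 := hy
    exact absurd h1 (by decide)

/-- The walk stays in the copy of the acting group. -/
theorem displacesMass_of_trivial_lamp (μA : PMF A) {μB : PMF (Multiplicative ℤ)}
    (hB : ∀ b, b ≠ 1 → μB b = 0) {α : ℝ} (hα : 0 < α) : DisplacesMass (swsMeasure μA μB) α := by
  refine displacesMass_of_subgroup (H := (walkHom A (Multiplicative ℤ)).range)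
    (fun g hg => ?_) (y := switchElt (ofAdd 1)) ?_ hα
  · obtain ⟨a, -, b, hb, b', hb', rfl⟩ := exists_of_mem_support_swsMeasure hg
    have hb1 : b = 1 := by_contra fun h => hb (hB b h)
    have hb1' : b' = 1 := by_contra fun h => hb' (hB b' h)
    have h1 : switchElt (A := A) (1 : Multiplicative ℤ) = 1 := (switchHom A _).map_one
    rw [hb1, hb1', h1, one_mul, mul_one]
    exact ⟨a, rfl⟩
  · rintro ⟨a, ha⟩
    have h1 := congrArg (fun g => g.1.left 1) ha
    have h2 : (1 : Multiplicative ℤ) = ofAdd 1 := h1.trans (switchElt_left_one _)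
    exact absurd h2 (by decide)

/-- The walker must be checked for triviality at every level, because a nontrivial step is what
makes the lamp measure symmetric. Trivial lamps need separate treatment only over `ℤ`; higher up the
induction hypothesis covers them. -/
theorem displacesMass_iterWreath (j : ℕ) (μ : PMF (iterWreath (j + 1)))
    (hsws : IsSwitchWalkSwitch (j + 1) μ) (hsymm : IsSymmPMF μ) (hfin : μ.support.Finite) :
    DisplacesMass μ (1 / 2 ^ (j + 2)) := by
  induction j with
  | zero =>
    obtain ⟨μA, μB, -, rfl⟩ := hsws
    change PMF (Multiplicative ℤ) at μB
    change IsSymmPMF (swsMeasure μA μB) at hsymm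
    change (swsMeasure μA μB).support.Finite at hfin
    change DisplacesMass (swsMeasure μA μB) _
    by_cases hA : ∀ a, a ≠ 1 → μA a = 0
    · exact displacesMass_of_trivial_walk μB hA (by positivity)
    by_cases hB : ∀ b, b ≠ 1 → μB b = 0
    · exact displacesMass_of_trivial_lamp μA hB (by positivity)
    push Not at hA hB
    obtain ⟨a, ha1, ha⟩ := hA
    obtain ⟨b, hb1, hb⟩ := hB
    have h := displacesMass_swsMeasure_int (walk_support_finite hfin) (walk_isSymm hsymm) ha1 ha
      (lamp_support_finite hfin) (lamp_isSymm hsymm ha1 ha) hb1 hb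
    norm_num at h ⊢
    exact h
  | succ j ih =>
    obtain ⟨μA, μB, hB, rfl⟩ := hsws
    change IsSymmPMF (swsMeasure μA μB) at hsymm
    change (swsMeasure μA μB).support.Finite at hfin
    change DisplacesMass (swsMeasure μA μB) _
    by_cases hA : ∀ a, a ≠ 1 → μA a = 0
    · exact displacesMass_of_trivial_walk μB hA (by positivity)
    push Not at hA
    obtain ⟨a, ha1, ha⟩ := hA
    have h := (ih μB hB (lamp_isSymm hsymm ha1 ha) (lamp_support_finite hfin)).swsMeasure
      (walk_support_finite hfin) (walk_isSymm hsymm) ha1 ha (by positivity)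
    have e : (1 : ℝ) / 2 ^ (j + 2) / 2 = 1 / 2 ^ (j + 1 + 2) := by
      rw [div_div, ← pow_succ]
    rwa [e] at h

end Iterated

theorem mainTheorem3 (j : ℕ) (hj : 1 ≤ j) (μ : PMF (iterWreath j))
    (hsws : IsSwitchWalkSwitch j μ) (hsymm : IsSymmPMF μ) (hfin : μ.support.Finite) :
    ∃ C : ℝ, 0 < C ∧ ∀ S : Finset (iterWreath j),
      Subgroup.closure (S : Set (iterWreath j)) = ⊤ →
      AlmostInvarianceRadiusLE S μ
        (fun n => C * ((n : ℝ) ^ ((1 : ℝ) / 2 ^ (j + 1)) / Real.sqrt (Real.log n))) := by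
  obtain ⟨j, rfl⟩ := Nat.exists_eq_succ_of_ne_zero (by omega : j ≠ 0)
  -- Any constant would do: the relation compares with scales whose ratio to `r` is unbounded.
  refine ⟨1, one_pos, fun S hS => ?_⟩
  simp only [one_mul]
  exact (displacesMass_iterWreath j μ hsws hsymm hfin).almostInvarianceRadiusLE hsymm
    (by positivity) hS
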